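/- \textbf{Setting.} Let $(\Omega,P)$ be a probability space, $\mathbb T=\mathbb Z_{\ge 0}$ or $\mathbb Z$, and $(\theta_t)_{t\in\mathbb T}$ a semigroup (group) of measurable $P$-preserving maps of $\Omega$. Let $M$ be a measurable space and $T$ a random dynamical system on $M$ over $\theta$: the maps $(\omega,x)\mapsto T^t_\omega x$ are measurable, $T^0_\omega=\mathrm{id}$, and $T^{t+s}_\omega=T^t_{\theta_s\omega}\circ T^s_\omega$. For an initial condition $(x_0,\omega_0)$ write $\omega_t=\theta_t\omega_0$, $x_t=T^t_{\omega_0}x_0$. Assume that (i) $\{x_t\}_{t\ge 0}$, $x_0\in M$, is a time-homogeneous Markov family: for every fixed $x_0$, all $s,t\ge0$ and measurable $A$, $P(x_{t+s}\in A\mid x_0,\dots,x_t)=p_s(x_t,A)$ a.s., where $p_s(y,A)=P\{\omega: T^s_\omega y\in A\}$; (ii) $\mu$ is an invariant probability measure: $\int_\Omega\mu((T^t_\omega)^{-1}A)\,dP=\mu(A)$ for all $t\ge0$ and measurable $A$; (iii) the system is ergodic: every measurable $A$ with $\int_A P\{\omega: T^t_\omega x\in A\}\,d\mu(x)=\mu(A)$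 for all $t\ge0$ has $\mu(A)\in\{0,1\}$. Let $\mathcal K$ be the stochastic Koopman operator on $L^2(\mu)$, $\mathcal Kf(x)=\int_\Omega f(T^1_\omega x)\,dP(\omega)$. \textbf{Observable.} Let $\tilde{\mathbf f}:\Omega\times M\to\mathbb C^k$, $(\omega,x)\mapsto\tilde{\mathbf f}_\omega(x)$, have i.i.d. measurement noise: the random functions $\tilde{\mathbf f}_{\omega_t}$, $t\ge 0$, are i.i.d. and, as a process, independent of the dynamics. Precisely, there is a sub-$\sigma$-algebra $\mathcal N$ of $\Omega$ such that $\tilde{\mathbf f}$ is jointly measurable with respect to $\mathcal N$ and the $\sigma$-algebra of $M$, the $\sigma$-algebras $\theta_t^{-1}\mathcal N$, $t\ge0$, are independent, and they are jointly independent of the $\sigma$-algebra generated by all maps $\omega\mapsto T^n_{\theta_t\omega}x$ ($t,n\ge0$, $x\in M$). (They are identically distributed because $\theta_t$ preserves $P$.) Write $\tilde{\mathbf f}(t)=\tilde{\mathbf f}_{\omega_t}(x_t)$ and let $\mathbf f=(f_1,\dots,f_k)^T$, $f_i(x)=\int_\Omega(\tilde{\mathbf f}_\omega(x))_i\,dP(\omega)$.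 Assume that $f_i\in L^2(\mu)$ and that the absolute means are in $L^2(\mu)$ as well: $\int_M\big(\int_\Omega|(\tilde{\mathbf f}_\omega(x))_i|\,dP(\omega)\big)^2d\mu(x)<\infty$ for each $i$. Suppose that $f_1,\dots,f_k$ span a $k$-dimensional subspace $\mathscr F$ of $L^2(\mu)$ that is invariant under $\mathcal K$, and that $\mathcal K|_{\mathscr F}$ has full rank $k$. Let $\mathbf K\in\mathbb C^{k\times k}$ be the matrix of the restriction of $\mathcal K$ to $\mathscr F$, that is, $\mathcal Kf_i=\sum_j\mathbf K_{ij}f_j$ for each $i$. \textbf{Algorithm (noise resistant DMD) with the delayed dual observable $\tilde{\mathbf g}(t)=\tilde{\mathbf f}(t-1)$.} From the data recorded at times $t=1,\dots,n+1$ (time $1$ being the first time at which $\tilde{\mathbf g}$ is defined for $\mathbb T=\mathbb Z_{\ge0}$) form \[X=[\tilde{\mathbf f}(1)\ \cdots\ \tilde{\mathbf f}(n)],\quad Y=[\tilde{\mathbf f}(2)\ \cdots\ \tilde{\mathbf f}(n+1)],\quad Z=[\tilde{\mathbf g}(1)\ \cdots\ \tilde{\mathbf g}(n)]=[\tilde{\mathbf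 f}(0)\ \cdots\ \tilde{\mathbf f}(n-1)],\] \[\tilde G_{0,n}=\tfrac1n XZ^*,\qquad \tilde G_{1,n}=\tfrac1n YZ^*,\qquad C_n=\tilde G_{1,n}\tilde G_{0,n}^{\dagger},\] where $\dagger$ is the Moore--Penrose pseudoinverse. \textbf{Conclusion.} For $(\mu\times P)$-almost every initial condition $(x_0,\omega_0)$, $C_n\to\mathbf K$ as $n\to\infty$. -/

import Mathlib

open MeasureTheory ProbabilityTheory Filter Topology Matrix
open scoped ENNReal

noncomputable section

/-! ### Moore-Penrose pseudoinverse -/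

/-- The Moore-Penrose pseudoinverse `A† = (AᴴA)† Aᴴ`, where the pseudoinverse of the Hermitian
matrix `AᴴA = U diag(λ) Uᴴ` is `U diag(λ⁻¹) Uᴴ` with the convention `0⁻¹ = 0`. The four Penrose
conditions, and the fact that they determine `A†`, are proved below. -/
def pinv {m n : Type*} [Fintype m] [Fintype n] [DecidableEq n] (A : Matrix m n ℂ) :
    Matrix n m ℂ :=
  let hA := isHermitian_conjTranspose_mul_self A
  let U : Matrix n n ℂ := hA.eigenvectorUnitary
  (U * diagonal (fun i => ((hA.eigenvalues i : ℝ) : ℂ)⁻¹) * Uᴴ) * Aᴴ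

/-- The four Penrose conditions: `B` is the Moore-Penrose pseudoinverse of `A`. -/
structure IsMoorePenrose {m n : Type*} [Fintype m] [Fintype n]
    (A : Matrix m n ℂ) (B : Matrix n m ℂ) : Prop where
  mul_mul_left : A * B * A = A
  mul_mul_right : B * A * B = B
  hermitian_left : (A * B)ᴴ = A * B
  hermitian_right : (B * A)ᴴ = B * A

theorem IsMoorePenrose.unique {m n : Type*} [Fintype m] [Fintype n]
    {A : Matrix m n ℂ} {B C : Matrix n m ℂ}
    (hB : IsMoorePenrose A B) (hC : IsMoorePenrose A C) : B = C := by
  have h1 : A * B = A * C := by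
    calc A * B = (A * B)ᴴ := hB.hermitian_left.symm
      _ = ((A * C) * (A * B))ᴴ := by
          rw [← Matrix.mul_assoc (A * C) A B, hC.mul_mul_left]
      _ = (A * B) * (A * C) := by
          rw [conjTranspose_mul, hB.hermitian_left, hC.hermitian_left]
      _ = A * C := by rw [← Matrix.mul_assoc (A * B) A C, hB.mul_mul_left]
  have h2 : B * A = C * A := by
    calc B * A = (B * A)ᴴ := hB.hermitian_right.symm
      _ = ((B * A) * (C * A))ᴴ := by
          rw [Matrix.mul_assoc B A (C * A), ← Matrix.mul_assoc A C A, hC.mul_mul_left]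
      _ = (C * A) * (B * A) := by
          rw [conjTranspose_mul, hB.hermitian_right, hC.hermitian_right]
      _ = C * A := by
          rw [Matrix.mul_assoc C A (B * A), ← Matrix.mul_assoc A B A, hB.mul_mul_left]
  calc B = B * A * B := hB.mul_mul_right.symm
    _ = C * A * B := by rw [h2]
    _ = C * (A * C) := by rw [Matrix.mul_assoc, h1]
    _ = C := by rw [← Matrix.mul_assoc, hC.mul_mul_right]

open scoped ComplexOrder in
theorem isMoorePenrose_pinv {m n : Type*} [Fintype m] [Fintype n] [DecidableEq n]
    (A : Matrix m n ℂ) : IsMoorePenrose A (pinv A) := by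
  have hA := isHermitian_conjTranspose_mul_self A
  set U : Matrix n n ℂ := (hA.eigenvectorUnitary : Matrix n n ℂ) with hU
  set D : Matrix n n ℂ := diagonal (fun i => ((hA.eigenvalues i : ℝ) : ℂ)) with hD
  set E : Matrix n n ℂ := diagonal (fun i => ((hA.eigenvalues i : ℝ) : ℂ)⁻¹) with hE
  have hUU : Uᴴ * U = 1 := by
    rw [hU]; exact Unitary.coe_star_mul_self hA.eigenvectorUnitary
  have hspec : Aᴴ * A = U * D * Uᴴ := by
    have := hA.spectral_theorem
    rw [Unitary.conjStarAlgAut_apply] at this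
    exact this
  have hp : pinv A = U * E * Uᴴ * Aᴴ := rfl
  have hDED : D * E * D = D := by
    rw [hD, hE, diagonal_mul_diagonal, diagonal_mul_diagonal]
    congr 1; funext i; exact mul_inv_mul_cancel _
  have hEDE : E * D * E = E := by
    rw [hD, hE, diagonal_mul_diagonal, diagonal_mul_diagonal]
    congr 1; funext i
    by_cases h : ((hA.eigenvalues i : ℝ) : ℂ) = 0 <;> simp [h]
  have hEh : Eᴴ = E := by
    rw [hE, diagonal_conjTranspose]
    congr 1; funext i; simp
  have hEDh : (E * D)ᴴ = E * D := by
    rw [hD, hE, diagonal_mul_diagonal, diagonal_conjTranspose]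
    congr 1; funext i; simp
  have hBA : pinv A * A = U * (E * D) * Uᴴ := by
    rw [hp, Matrix.mul_assoc _ Aᴴ A, hspec]
    calc U * E * Uᴴ * (U * D * Uᴴ) = U * E * (Uᴴ * U) * D * Uᴴ := by
          simp only [Matrix.mul_assoc]
      _ = _ := by rw [hUU]; simp only [Matrix.mul_assoc, Matrix.mul_one]
  refine ⟨?_, ?_, ?_, ?_⟩
  · have h0 : (Aᴴ * A) * (pinv A * A - 1) = 0 := by
      rw [hBA, Matrix.mul_sub, Matrix.mul_one, hspec]
      calc U * D * Uᴴ * (U * (E * D) * Uᴴ) - U * D * Uᴴ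
          = U * D * (Uᴴ * U) * (E * D) * Uᴴ - U * D * Uᴴ := by simp only [Matrix.mul_assoc]
        _ = U * (D * E * D) * Uᴴ - U * D * Uᴴ := by
            rw [hUU]; simp only [Matrix.mul_assoc, Matrix.mul_one]
        _ = 0 := by rw [hDED, sub_self]
    have h1 := (conjTranspose_mul_self_mul_eq_zero A _).1 h0
    rw [Matrix.mul_sub, Matrix.mul_one, sub_eq_zero, ← Matrix.mul_assoc] at h1
    exact h1
  · rw [hBA, hp]
    calc U * (E * D) * Uᴴ * (U * E * Uᴴ * Aᴴ)
        = U * (E * D) * (Uᴴ * U) * E * Uᴴ * Aᴴ := by simp only [Matrix.mul_assoc]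
      _ = U * (E * D * E) * Uᴴ * Aᴴ := by
          rw [hUU]; simp only [Matrix.mul_assoc, Matrix.mul_one]
      _ = _ := by rw [hEDE]
  · rw [hp]
    simp only [conjTranspose_mul, conjTranspose_conjTranspose, hEh, Matrix.mul_assoc]
  · rw [hBA]
    simp only [conjTranspose_mul, conjTranspose_conjTranspose]
    rw [← conjTranspose_mul, hEDh]
    simp only [Matrix.mul_assoc]

/-! ### Noise resistant dynamic mode decomposition -/

/-- The matrix `C` computed by noise resistant DMD from the data `u 0, …, u n` (snapshots of the
observable) and `v 0, …, v (n - 1)` (snapshots of the dual observable): with the data matrices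
`X = [u 0 ⋯ u (n-1)]`, `Y = [u 1 ⋯ u n]`, `Z = [v 0 ⋯ v (n-1)]`, put `G₀ = (1/n) X Zᴴ` and
`G₁ = (1/n) Y Zᴴ`; then `C = G₁ G₀†`. -/
def noiseResistantDMD {k l : ℕ} (u : ℕ → Fin k → ℂ) (v : ℕ → Fin l → ℂ) (n : ℕ) :
    Matrix (Fin k) (Fin k) ℂ :=
  let X : Matrix (Fin k) (Fin n) ℂ := Matrix.of fun i m => u m i
  let Y : Matrix (Fin k) (Fin n) ℂ := Matrix.of fun i m => u (m + 1) i
  let Z : Matrix (Fin l) (Fin n) ℂ := Matrix.of fun i m => v m i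
  let G₀ : Matrix (Fin k) (Fin l) ℂ := (1 / (n : ℂ)) • (X * Zᴴ)
  let G₁ : Matrix (Fin k) (Fin l) ℂ := (1 / (n : ℂ)) • (Y * Zᴴ)
  G₁ * pinv G₀

/-! ### Random dynamical systems -/

/-- A random dynamical system on `M` with time `𝕋` (below: `ℕ` or `ℤ`, or any additive monoid with
a distinguished unit of time), over the driving system `θ` on the probability space `(Ω, P)`. -/
structure RandomDynSys (𝕋 : Type*) [AddMonoidWithOne 𝕋] {Ω : Type*} {_ : MeasurableSpace Ω}
    (P : Measure Ω) (M : Type*) [MeasurableSpace M] where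
  /-- the driving flow -/
  θ : 𝕋 → Ω → Ω
  θ_zero : θ 0 = id
  θ_add : ∀ s t, θ (t + s) = θ t ∘ θ s
  measurePreserving_θ : ∀ t, MeasurePreserving (θ t) P P
  /-- the cocycle `T t ω : M → M` -/
  T : 𝕋 → Ω → M → M
  measurable_T : ∀ t, Measurable fun p : Ω × M => T t p.1 p.2
  T_zero : ∀ ω, T 0 ω = id
  T_add : ∀ s t ω, T (t + s) ω = T t (θ s ω) ∘ T s ω

namespace RandomDynSys

variable {𝕋 : Type*} [AddMonoidWithOne 𝕋] {Ω : Type*} {mΩ : MeasurableSpace Ω} {P : Measure Ω}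
  {M : Type*} [mM : MeasurableSpace M]

/-- For every initial state `x`, the process `x_n = T n ω x` is a Markov process for its natural
filtration, and its transition probabilities `p_s(y, A) = P(T s ω y ∈ A)` depend neither on the
time nor on `x`: `P(x_{t+s} ∈ A | x_0, …, x_t) = p_s(x_t, A)` almost surely. -/
def IsMarkovFamily (Φ : RandomDynSys 𝕋 P M) : Prop :=
  ∀ (x : M) (s t : ℕ) (A : Set M), MeasurableSet A →
    P[Set.indicator {ω | Φ.T ((t + s : ℕ) : 𝕋) ω x ∈ A} (fun _ => (1 : ℝ)) |
        ⨆ r : Fin (t + 1), mM.comap (fun ω => Φ.T ((r : ℕ) : 𝕋) ω x)]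
      =ᵐ[P] fun ω => P.real {ω' | Φ.T (s : 𝕋) ω' (Φ.T (t : 𝕋) ω x) ∈ A}

/-- `μ` is an invariant measure (the system is weakly measure preserving):
`∫ μ((T n ω)⁻¹ A) dP(ω) = μ(A)`. -/
def IsInvariantMeasure (Φ : RandomDynSys 𝕋 P M) (μ : Measure M) : Prop :=
  ∀ (n : ℕ) (A : Set M), MeasurableSet A →
    ∫⁻ ω, μ (Φ.T (n : 𝕋) ω ⁻¹' A) ∂P = μ A

/-- `A` is an invariant set: `∫_A ∫ χ_A(T n ω x) dP(ω) dμ(x) = μ(A)` for every time `n`. -/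
def IsInvariantSet (Φ : RandomDynSys 𝕋 P M) (μ : Measure M) (A : Set M) : Prop :=
  MeasurableSet A ∧ ∀ n : ℕ, ∫⁻ x in A, P {ω | Φ.T (n : 𝕋) ω x ∈ A} ∂μ = μ A

/-- The system is ergodic: every invariant set has measure `0` or `1`. -/
def IsErgodic (Φ : RandomDynSys 𝕋 P M) (μ : Measure M) : Prop :=
  ∀ A : Set M, Φ.IsInvariantSet μ A → μ A = 0 ∨ μ A = 1

/-- The stochastic Koopman operators on functions, `(𝒦^t f)(x) = ∫ f(T t ω x) dP(ω)`. -/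
def koopman (Φ : RandomDynSys 𝕋 P M) (t : 𝕋) (f : M → ℂ) (x : M) : ℂ :=
  ∫ ω, f (Φ.T t ω x) ∂P

/-- If `μ` is invariant, the one-step map carries `μ × P` to `μ`. -/
theorem measurePreserving_T [IsProbabilityMeasure P] (Φ : RandomDynSys 𝕋 P M) {μ : Measure M}
    [IsProbabilityMeasure μ] (hμ : Φ.IsInvariantMeasure μ) :
    MeasurePreserving (fun p : M × Ω => Φ.T 1 p.2 p.1) (μ.prod P) μ := by
  have hm : Measurable (fun p : M × Ω => Φ.T 1 p.2 p.1) :=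
    (Φ.measurable_T 1).comp measurable_swap
  refine ⟨hm, ?_⟩
  ext A hA
  rw [Measure.map_apply hm hA, Measure.prod_apply_symm (hm hA)]
  have := hμ 1 A hA
  rw [Nat.cast_one] at this
  exact this

theorem koopman_congr [IsProbabilityMeasure P] (Φ : RandomDynSys 𝕋 P M) {μ : Measure M}
    [IsProbabilityMeasure μ] (hμ : Φ.IsInvariantMeasure μ) {f g : M → ℂ} (h : f =ᵐ[μ] g) :
    Φ.koopman 1 f =ᵐ[μ] Φ.koopman 1 g := by
  have h1 : ∀ᵐ p ∂(μ.prod P), f (Φ.T 1 p.2 p.1) = g (Φ.T 1 p.2 p.1) :=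
    (Φ.measurePreserving_T hμ).quasiMeasurePreserving.ae h
  filter_upwards [Measure.ae_ae_of_ae_prod h1] with x hx
  exact integral_congr_ae hx

theorem memLp_koopman [IsProbabilityMeasure P] (Φ : RandomDynSys 𝕋 P M) {μ : Measure M}
    [IsProbabilityMeasure μ] (hμ : Φ.IsInvariantMeasure μ) {f : M → ℂ} (hf : MemLp f 2 μ) :
    MemLp (Φ.koopman 1 f) 2 μ := by
  have hF : MemLp (fun p : M × Ω => f (Φ.T 1 p.2 p.1)) 2 (μ.prod P) :=
    hf.comp_measurePreserving (Φ.measurePreserving_T hμ)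
  have hmeas : AEStronglyMeasurable (Φ.koopman 1 f) μ :=
    hF.aestronglyMeasurable.integral_prod_right'
  refine ⟨hmeas, ?_⟩
  have hlt := hF.2
  rw [eLpNorm_lt_top_iff_lintegral_rpow_enorm_lt_top two_ne_zero ENNReal.ofNat_ne_top] at hlt ⊢
  rw [lintegral_prod _ (hF.aestronglyMeasurable.enorm.pow_const _)] at hlt
  refine lt_of_le_of_lt (lintegral_mono_ae ?_) hlt
  filter_upwards [hF.aestronglyMeasurable.prodMk_left] with x hx
  have h1 : ‖Φ.koopman 1 f x‖ₑ ≤ eLpNorm (fun ω => f (Φ.T 1 ω x)) 2 P := by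
    refine (enorm_integral_le_lintegral_enorm _).trans ?_
    rw [← eLpNorm_one_eq_lintegral_enorm]
    exact eLpNorm_le_eLpNorm_of_exponent_le one_le_two hx
  calc ‖Φ.koopman 1 f x‖ₑ ^ (2 : ℝ≥0∞).toReal
      ≤ eLpNorm (fun ω => f (Φ.T 1 ω x)) 2 P ^ (2 : ℝ≥0∞).toReal :=
        ENNReal.rpow_le_rpow h1 ENNReal.toReal_nonneg
    _ = ∫⁻ ω, ‖f (Φ.T 1 ω x)‖ₑ ^ (2 : ℝ≥0∞).toReal ∂P := by
        rw [eLpNorm_eq_lintegral_rpow_enorm_toReal two_ne_zero ENNReal.ofNat_ne_top,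
          ← ENNReal.rpow_mul]
        simp

/-- The (one-step) stochastic Koopman operator `𝒦` on `L²(μ)`, for an invariant probability
measure `μ`: the class of `f` goes to the class of `x ↦ ∫ f(T 1 ω x) dP(ω)`. -/
def koopmanL2 [IsProbabilityMeasure P] (Φ : RandomDynSys 𝕋 P M) {μ : Measure M}
    [IsProbabilityMeasure μ] (hμ : Φ.IsInvariantMeasure μ) : Lp ℂ 2 μ →ₗ[ℂ] Lp ℂ 2 μ where
  toFun f := (Φ.memLp_koopman hμ (Lp.memLp f)).toLp _
  map_add' f g := by
    rw [← MemLp.toLp_add]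
    refine (MemLp.toLp_eq_toLp_iff _ _).2 ?_
    refine (Φ.koopman_congr hμ (Lp.coeFn_add f g)).trans ?_
    have hi (h : Lp ℂ 2 μ) : ∀ᵐ x ∂μ, Integrable (fun ω => h (Φ.T 1 ω x)) P :=
      (((Lp.memLp h).comp_measurePreserving (Φ.measurePreserving_T hμ)).integrable
        one_le_two).prod_right_ae
    filter_upwards [hi f, hi g] with x hfx hgx
    exact integral_add hfx hgx
  map_smul' c f := by
    rw [RingHom.id_apply, ← MemLp.toLp_const_smul]
    refine (MemLp.toLp_eq_toLp_iff _ _).2 ?_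
    refine (Φ.koopman_congr hμ (Lp.coeFn_smul c f)).trans ?_
    filter_upwards with x
    exact integral_smul c _

theorem koopmanL2_coeFn [IsProbabilityMeasure P] (Φ : RandomDynSys 𝕋 P M) {μ : Measure M}
    [IsProbabilityMeasure μ] (hμ : Φ.IsInvariantMeasure μ) (f : Lp ℂ 2 μ) :
    Φ.koopmanL2 hμ f =ᵐ[μ] Φ.koopman 1 f :=
  MemLp.coeFn_toLp (Φ.memLp_koopman hμ (Lp.memLp f))

/-! ### Noisy observables -/

/-- The value `F(t) = F_{θ_t ω}(T t ω x)` recorded at time `t` along the trajectory with initial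
condition `(x, ω)`, for a noisy observable `F` with values in `ℂ^k`. -/
def sample (Φ : RandomDynSys 𝕋 P M) {k : ℕ} (F : Ω → M → Fin k → ℂ) (x : M) (ω : Ω) (t : 𝕋) :
    Fin k → ℂ :=
  F (Φ.θ t ω) (Φ.T t ω x)

/-- The σ-algebra on `Ω` generated by the dynamics, that is by all the random maps `T_{θ_t ω}^n`:
it is generated by the maps `ω ↦ T n (θ t ω) x`. -/
abbrev dynamicsAlgebra (Φ : RandomDynSys 𝕋 P M) : MeasurableSpace Ω :=
  ⨆ (t : ℕ) (n : ℕ) (x : M), mM.comap (fun ω => Φ.T (n : 𝕋) (Φ.θ (t : 𝕋) ω) x)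

/-- `F` is a (vector valued) noisy observable with i.i.d. measurement noise: the random functions
`F_{θ_t ω} : M → ℂ^k` are i.i.d. and, as a process, independent of the dynamics.

The random function `F_ω` is carried by a σ-algebra `𝒩` of measurement noise: `F` is measurable in
`(ω, x)` jointly when `Ω` is given `𝒩` (for instance `F_ω(x) = H(ξ(ω), x)` with `𝒩 = σ(ξ)`), so
that the random function `F_{θ_t ω}` is carried by `θ_t⁻¹ 𝒩`. These σ-algebras are independent of
each other, and jointly independent of the dynamics. That the random functions `F_{θ_t ω}` are
identically distributed is automatic, as `θ_t` preserves `P`. -/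
def HasIIDMeasurementNoise (Φ : RandomDynSys 𝕋 P M) {k : ℕ} (F : Ω → M → Fin k → ℂ) : Prop :=
  ∃ 𝒩 : MeasurableSpace Ω, 𝒩 ≤ mΩ ∧
    Measurable[𝒩.prod mM] (fun p : Ω × M => F p.1 p.2) ∧
    iIndep (fun t : ℕ => 𝒩.comap (Φ.θ (t : 𝕋))) P ∧
    Indep (⨆ t : ℕ, 𝒩.comap (Φ.θ (t : 𝕋))) Φ.dynamicsAlgebra P

end RandomDynSys

/-- The mean `f_i(x) = ∫ F_ω(x)_i dP(ω)` of the `i`-th component of a noisy observable. -/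
def obsMean {Ω M : Type*} [MeasurableSpace Ω] (P : Measure Ω) {k : ℕ} (F : Ω → M → Fin k → ℂ)
    (i : Fin k) (x : M) : ℂ :=
  ∫ ω, F ω x i ∂P

end

/-! Noises at two different times are independent of each other and of the motion, so in expectation
each sample may be replaced by its mean: for `s ≠ 0` the correlation of the data at lag `s` is `∫
(𝒦^s f_i) conj(f_j) dμ`. At lag `0` the noise would be correlated with itself and leave a bias; the
delayed dual observable avoids this, since `G₀` and `G₁` are then empirical correlations at lags `1`
and `2`. Put `G i j = ∫ f_i conj(f_j) dμ`. Invariance of the span and the Chapman-Kolmogorov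
equation (`koopman_two`) turn the two limits into `K G` and `K² G`. Linear independence makes `G`
invertible, full rank makes `K` invertible, and the pseudoinverse is continuous at invertible
matrices, so the output tends to `K² G (K G)⁻¹ = K`.

The analytic content is the almost sure convergence of the time averages. The skew product on `M ×
Ω` is not assumed ergodic, so Birkhoff's theorem is applied to the shift on the law of the path
`(x_t, ξ_t)` of states and noise variables. This is a stationary Markov law: the state moves by
`p_1` and the noise is drawn afresh from its law `η`, so that `μ × η` is stationary.

Ergodicity of this law has two ingredients. In `IsMarkovLaw.ergodic_pathShift`, the conditional
probability of a shift invariant event given the first `n + 1` coordinates is `h(w n)` with one `h`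
for all `n`; by Lévy's upward theorem it tends to the indicator of the event, and stationarity then
forces `h` to be `0` or `1`, so the event depends on `w 0` alone. In `ergodic_noisyPathLaw`, the
fresh noise forces a set of pairs that is never entered nor left to be, up to a null set, a set of
states, to which the ergodicity hypothesis applies. The state space is an arbitrary measurable
space, so conditional laws are replaced throughout by densities and uniqueness of Markov laws. -/

noncomputable section

/-! ### Birkhoff's pointwise ergodic theorem for ergodic maps -/

section Birkhoff

variable {α : Type*}

/-- The running maximum `max (0, S₁ f, …, Sₙ f)` of the Birkhoff sums of `f`. -/
def birkhoffMax (T : α → α) (f : α → ℝ) : ℕ → α → ℝ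
  | 0 => fun _ => 0
  | n + 1 => fun x => max 0 (f x + birkhoffMax T f n (T x))

theorem birkhoffMax_nonneg (T : α → α) (f : α → ℝ) (n : ℕ) (x : α) : 0 ≤ birkhoffMax T f n x := by
  cases n with
  | zero => exact le_rfl
  | succ n => exact le_max_left _ _

theorem birkhoffMax_le_succ (T : α → α) (f : α → ℝ) (n : ℕ) (x : α) :
    birkhoffMax T f n x ≤ birkhoffMax T f (n + 1) x := by
  induction n generalizing x with
  | zero => exact le_max_left _ _
  | succ n ih => exact max_le_max le_rfl (add_le_add le_rfl (ih _))

theorem birkhoffSum_le_birkhoffMax (T : α → α) (f : α → ℝ) (n : ℕ) (x : α) :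
    birkhoffSum T f n x ≤ birkhoffMax T f n x := by
  induction n generalizing x with
  | zero => simp [birkhoffMax]
  | succ n ih =>
    rw [birkhoffSum_succ']
    exact (add_le_add le_rfl (ih _)).trans (le_max_right _ _)

variable [MeasurableSpace α] {m : Measure α} {T : α → α} {f : α → ℝ}

theorem measurable_birkhoffMax (hT : Measurable T) (hf : Measurable f) (n : ℕ) :
    Measurable (birkhoffMax T f n) := by
  induction n with
  | zero => exact measurable_const
  | succ n ih => exact measurable_const.max (hf.add (ih.comp hT))

theorem integrable_birkhoffMax [IsFiniteMeasure m] (hT : MeasurePreserving T m m)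
    (hf : Integrable f m) (n : ℕ) : Integrable (birkhoffMax T f n) m := by
  induction n with
  | zero => exact integrable_const 0
  | succ n ih => exact (integrable_const 0).sup (hf.add (hT.integrable_comp_of_integrable ih))

/-- If `f` has negative mean, its Birkhoff sums are almost surely bounded above. -/
theorem Ergodic.ae_bddAbove_birkhoffSum [IsProbabilityMeasure m] (hT : Ergodic T m)
    (hfm : Measurable f) (hf : Integrable f m) (hneg : ∫ x, f x ∂m < 0) :
    ∀ᵐ x ∂m, ∃ C, ∀ n, birkhoffSum T f n x ≤ C := by
  -- The recursion defining `birkhoffMax` makes boundedness at `x` and at `T x` equivalent, so this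
  -- set is null or full.
  set B : Set α := {x | ∃ C : ℕ, ∀ n, birkhoffMax T f n x ≤ C} with hB
  have hBm : MeasurableSet B := by
    have : B = ⋃ C : ℕ, ⋂ n, {x | birkhoffMax T f n x ≤ C} := by ext; simp [hB]
    rw [this]
    exact .iUnion fun C => .iInter fun n =>
      measurableSet_le (measurable_birkhoffMax hT.measurable hfm n) measurable_const
  have hBT : T ⁻¹' B = B := by
    ext x
    constructor
    · rintro ⟨C, hC⟩
      obtain ⟨D, hD⟩ := exists_nat_ge (f x + C)
      refine ⟨D, fun n => ?_⟩
      refine (birkhoffMax_le_succ T f n x).trans (max_le D.cast_nonneg ?_)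
      linarith [hC n]
    · rintro ⟨C, hC⟩
      obtain ⟨D, hD⟩ := exists_nat_ge (C - f x)
      refine ⟨D, fun n => ?_⟩
      have := (le_max_right _ _).trans (hC (n + 1))
      linarith
  rcases hT.toPreErgodic.ae_mem_or_ae_notMem hBm hBT with h | h
  · filter_upwards [h] with x ⟨C, hC⟩
    exact ⟨C, fun n => (birkhoffSum_le_birkhoffMax T f n x).trans (hC n)⟩
  · exfalso
    -- In the null case the running maxima `M_n` are almost surely unbounded. Then `M_{n+1} - M_n ∘
    -- T = max (-M_n ∘ T) f` equals `f` from some `n` on and is dominated by `|f|`, while its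
    -- integral is that of `M_{n+1} - M_n`, which is nonnegative. Hence `∫ f ≥ 0`, a contradiction.
    set D : ℕ → α → ℝ := fun n x => birkhoffMax T f (n + 1) x - birkhoffMax T f n (T x) with hD
    have hDeq : ∀ n x, D n x = max (-birkhoffMax T f n (T x)) (f x) := by
      intro n x
      simp only [hD, birkhoffMax, ← max_sub_sub_right]
      congr 1 <;> ring
    have hint := integrable_birkhoffMax hT.toMeasurePreserving hf
    have hintT : ∀ n, Integrable (fun x => birkhoffMax T f n (T x)) m := fun n =>
      hT.toMeasurePreserving.integrable_comp_of_integrable (hint n)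
    have hDpos : ∀ n, 0 ≤ ∫ x, D n x ∂m := by
      intro n
      rw [integral_sub (hint _) (hintT n)]
      have h1 : ∫ x, birkhoffMax T f n (T x) ∂m = ∫ x, birkhoffMax T f n x ∂m := by
        rw [← integral_map hT.measurable.aemeasurable
          (by rw [hT.map_eq]; exact (hint n).aestronglyMeasurable), hT.map_eq]
      rw [h1, sub_nonneg]
      exact integral_mono (hint _) (hint _) (birkhoffMax_le_succ T f n)
    have hlim : Tendsto (fun n => ∫ x, D n x ∂m) atTop (𝓝 (∫ x, f x ∂m)) := by
      refine tendsto_integral_of_dominated_convergence (fun x => |f x|)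
        (fun n => ((hint _).sub (hintT n)).aestronglyMeasurable) hf.abs ?_ ?_
      · intro n
        filter_upwards with x
        rw [hDeq, Real.norm_eq_abs, abs_le]
        refine ⟨(neg_abs_le _).trans (le_max_right _ _), max_le ?_ (le_abs_self _)⟩
        exact (neg_nonpos.2 (birkhoffMax_nonneg T f n _)).trans (abs_nonneg _)
      · filter_upwards [h] with x hx
        rw [← hBT] at hx
        obtain ⟨C, hC⟩ := exists_nat_ge (-f x)
        have : ∃ n, (C : ℝ) < birkhoffMax T f n (T x) := by
          by_contra! hcon
          exact hx ⟨C, hcon⟩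
        obtain ⟨N, hN⟩ := this
        refine tendsto_const_nhds.congr' ?_
        filter_upwards [eventually_ge_atTop N] with n hn
        rw [hDeq, max_eq_right]
        have := monotone_nat_of_le_succ (fun n => birkhoffMax_le_succ T f n (T x)) hn
        exact (neg_le_neg (hN.le.trans this)).trans (by linarith)
    exact absurd (ge_of_tendsto' hlim hDpos) (not_le.2 hneg)

/-- **Birkhoff's pointwise ergodic theorem** for an ergodic map and a real function. -/
theorem Ergodic.ae_tendsto_birkhoffSum_div [IsProbabilityMeasure m] (hT : Ergodic T m)
    (hfm : Measurable f) (hf : Integrable f m) :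
    ∀ᵐ x ∂m, Tendsto (fun n : ℕ => birkhoffSum T f n x / n) atTop (𝓝 (∫ x, f x ∂m)) := by
  set c := ∫ x, f x ∂m with hc
  -- Both `f - (c + ε)` and `(c - ε) - f` have mean `-ε < 0`. Restricting to `ε = 1/(j+1)` leaves
  -- countably many null sets.
  have key : ∀ᵐ x ∂m, ∀ j : ℕ, ∃ C, ∀ n : ℕ,
      |birkhoffSum T f n x - n * c| ≤ C + n * (1 / ((j : ℝ) + 1)) := by
    rw [ae_all_iff]
    intro j
    have hε : 0 < 1 / ((j : ℝ) + 1) := Nat.one_div_pos_of_nat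
    set ε := 1 / ((j : ℝ) + 1)
    have h1 := hT.ae_bddAbove_birkhoffSum (f := fun x => f x - (c + ε))
      (hfm.sub_const _) (hf.sub (integrable_const _)) (by
        rw [integral_sub hf (integrable_const _)]; simp; linarith)
    have h2 := hT.ae_bddAbove_birkhoffSum (f := fun x => (c - ε) - f x)
      (measurable_const.sub hfm) ((integrable_const _).sub hf) (by
        rw [integral_sub (integrable_const _) hf]; simp; linarith)
    filter_upwards [h1, h2] with x ⟨C, hC⟩ ⟨D, hD⟩
    refine ⟨max C D, fun n => ?_⟩
    have hC := hC n
    have hD := hD n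
    simp only [birkhoffSum, Finset.sum_sub_distrib, Finset.sum_const, Finset.card_range,
      nsmul_eq_mul] at hC hD ⊢
    rw [abs_le]
    constructor
    · nlinarith [le_max_right C D]
    · nlinarith [le_max_left C D]
  filter_upwards [key] with x hx
  rw [Metric.tendsto_atTop]
  intro ε hε
  obtain ⟨j, hj⟩ := exists_nat_one_div_lt (half_pos hε)
  obtain ⟨C, hC⟩ := hx j
  obtain ⟨N, hN⟩ := exists_nat_gt (C / (ε / 2))
  refine ⟨N + 1, fun n hn => ?_⟩
  have hn0 : (0 : ℝ) < n := by exact_mod_cast (by omega : 0 < n)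
  have hNn : (N : ℝ) < n := by exact_mod_cast (by omega : N < n)
  rw [Real.dist_eq, div_sub' hn0.ne', abs_div, abs_of_pos hn0, div_lt_iff₀ hn0]
  have h3 := hC n
  have h4 : C < n * (ε / 2) := by
    rw [div_lt_iff₀ (half_pos hε)] at hN
    nlinarith
  nlinarith

/-- **Birkhoff's pointwise ergodic theorem** for an ergodic map and a complex function. -/
theorem Ergodic.ae_tendsto_birkhoffSum_complex [IsProbabilityMeasure m] (hT : Ergodic T m)
    {g : α → ℂ} (hgm : Measurable g) (hg : Integrable g m) :
    ∀ᵐ x ∂m, Tendsto (fun n : ℕ => 1 / (n : ℂ) * birkhoffSum T g n x) atTop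
      (𝓝 (∫ x, g x ∂m)) := by
  have h1 := hT.ae_tendsto_birkhoffSum_div (Complex.measurable_re.comp hgm) hg.re
  have h2 := hT.ae_tendsto_birkhoffSum_div (Complex.measurable_im.comp hgm) hg.im
  filter_upwards [h1, h2] with x hx1 hx2
  have h3 := ((Complex.continuous_ofReal.tendsto _).comp hx1).add
    (((Complex.continuous_ofReal.tendsto _).comp hx2).mul_const Complex.I)
  have h4 : ((∫ x, (g x).re ∂m : ℝ) : ℂ) + ((∫ x, (g x).im ∂m : ℝ) : ℂ) *
      Complex.I = ∫ x, g x ∂m := integral_re_add_im hg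
  rw [← h4]
  refine h3.congr fun n => ?_
  have h5 : birkhoffSum T g n x = ((birkhoffSum T (Complex.re ∘ g) n x : ℝ) : ℂ) +
      ((birkhoffSum T (Complex.im ∘ g) n x : ℝ) : ℂ) * Complex.I := by
    simp only [birkhoffSum, Complex.ofReal_sum, Finset.sum_mul, ← Finset.sum_add_distrib,
      Function.comp, Complex.re_add_im]
  rw [h5]
  simp only [Function.comp, Complex.ofReal_div, Complex.ofReal_natCast]
  ring

end Birkhoff

/-! ### Stationary Markov sequences -/

section MarkovSequences

/-- The join of two σ-algebras is generated by the intersections of their (generating) sets. -/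
theorem sup_eq_generateFrom_inter {α : Type*} (m₁ m₂ : MeasurableSpace α) {S : Set (Set α)}
    (hS : m₂ = MeasurableSpace.generateFrom S) (huniv : Set.univ ∈ S) :
    m₁ ⊔ m₂ = MeasurableSpace.generateFrom
      {s | ∃ C A, MeasurableSet[m₁] C ∧ A ∈ S ∧ s = C ∩ A} := by
  apply le_antisymm
  · refine sup_le ?_ ?_
    · intro C hC
      exact MeasurableSpace.measurableSet_generateFrom
        ⟨C, Set.univ, hC, huniv, (Set.inter_univ C).symm⟩
    · rw [hS]
      refine MeasurableSpace.generateFrom_le fun A hA => ?_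
      exact MeasurableSpace.measurableSet_generateFrom
        ⟨Set.univ, A, MeasurableSet.univ, hA, (Set.univ_inter A).symm⟩
  · refine MeasurableSpace.generateFrom_le ?_
    rintro _ ⟨C, A, hC, hA, rfl⟩
    have hA' : MeasurableSet[m₂] A := by
      rw [hS]; exact MeasurableSpace.measurableSet_generateFrom hA
    exact MeasurableSet.inter (le_sup_left (a := m₁) (b := m₂) _ hC)
      (le_sup_right (a := m₁) (b := m₂) _ hA')

theorem isPiSystem_inter {α : Type*} (m₁ : MeasurableSpace α) {S : Set (Set α)}
    (hS : IsPiSystem S) :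
    IsPiSystem {s | ∃ C A, MeasurableSet[m₁] C ∧ A ∈ S ∧ s = C ∩ A} := by
  rintro _ ⟨C, A, hC, hA, rfl⟩ _ ⟨D, B, hD, hB, rfl⟩ hne
  refine ⟨C ∩ D, A ∩ B, hC.inter hD, hS A hA B hB (hne.mono ?_), ?_⟩
  · exact fun x hx => ⟨hx.1.2, hx.2.2⟩
  · exact Set.inter_inter_inter_comm _ _ _ _

/-- Finite measures that agree on the intersections of the sets of two σ-algebras agree on their
join. -/
theorem measure_eq_of_inter_eq {α : Type*} {m₁ m₂ m₀ : MeasurableSpace α} (hm₁ : m₁ ≤ m₀)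
    (hm₂ : m₂ ≤ m₀) {ν ν' : Measure[m₀] α} [IsFiniteMeasure ν]
    (h : ∀ C D, MeasurableSet[m₁] C → MeasurableSet[m₂] D → ν (C ∩ D) = ν' (C ∩ D))
    {B : Set α} (hB : MeasurableSet[m₁ ⊔ m₂] B) : ν B = ν' B := by
  have huniv := h Set.univ Set.univ MeasurableSet.univ MeasurableSet.univ
  rw [Set.inter_univ] at huniv
  refine ext_on_measurableSpace_of_generate_finite m₀ _ ?_ (sup_le hm₁ hm₂)
    (sup_eq_generateFrom_inter m₁ m₂ (S := {s | MeasurableSet[m₂] s})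
      (@MeasurableSpace.generateFrom_measurableSet _ m₂).symm (@MeasurableSet.univ _ m₂))
    (isPiSystem_inter m₁ (@MeasurableSpace.isPiSystem_measurableSet _ m₂)) huniv hB
  rintro _ ⟨C, D, hC, hD, rfl⟩
  exact h C D hC hD

/-- Measures that agree on a σ-algebra give the same integral to its measurable functions. -/
theorem lintegral_congr_of_measurableSet {α : Type*} {m m₀ : MeasurableSpace α} (hm : m ≤ m₀)
    {ν ν' : Measure[m₀] α} (h : ∀ C, MeasurableSet[m] C → ν C = ν' C) {f : α → ℝ≥0∞}
    (hf : Measurable[m] f) : ∫⁻ x, f x ∂ν = ∫⁻ x, f x ∂ν' := by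
  rw [← lintegral_trim hm hf, ← lintegral_trim hm hf]
  congr 1
  refine @Measure.ext _ m _ _ fun C hC => ?_
  rw [trim_measurableSet_eq hm hC, trim_measurableSet_eq hm hC, h C hC]

theorem setLIntegral_congr_of_measurableSet {α : Type*} {m m₀ : MeasurableSpace α} (hm : m ≤ m₀)
    {ν ν' : Measure[m₀] α} (h : ∀ C, MeasurableSet[m] C → ν C = ν' C) {f : α → ℝ≥0∞}
    (hf : Measurable[m] f) {C : Set α} (hC : MeasurableSet[m] C) :
    ∫⁻ x in C, f x ∂ν = ∫⁻ x in C, f x ∂ν' := by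
  rw [← lintegral_indicator (hm _ hC), ← lintegral_indicator (hm _ hC)]
  exact lintegral_congr_of_measurableSet hm h (hf.indicator hC)

/-- The shift of sequences by `n` places. -/
def pathShift {E : Type*} (n : ℕ) (w : ℕ → E) : ℕ → E := fun i => w (n + i)

theorem iterate_pathShift_one {E : Type*} (n : ℕ) : (pathShift (E := E) 1)^[n] = pathShift n := by
  induction n with
  | zero => funext w i; simp [pathShift]
  | succ n ih =>
    rw [Function.iterate_succ', ih]
    funext w i
    simp only [Function.comp, pathShift]
    congr 1; omega

variable {E : Type*} [mE : MeasurableSpace E]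

theorem measurable_pathShift (n : ℕ) : Measurable (pathShift (E := E) n) :=
  measurable_pi_lambda _ fun i => measurable_pi_apply (n + i)

/-- The filtration of the coordinate process on sequences. -/
def coordFiltration (E : Type*) [mE : MeasurableSpace E] :
    Filtration ℕ (MeasurableSpace.pi : MeasurableSpace (ℕ → E)) where
  seq n := ⨆ (i : ℕ) (_ : i ≤ n), mE.comap fun w => w i
  mono' _ _ h := iSup₂_le fun i hi =>
    le_iSup₂ (f := fun (i : ℕ) (_ : i ≤ _) => mE.comap fun w : ℕ → E => w i) i (hi.trans h)
  le' _ := iSup₂_le fun i _ => (measurable_pi_apply i).comap_le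

theorem measurable_coord {i n : ℕ} (h : i ≤ n) :
    Measurable[coordFiltration E n] fun w : ℕ → E => w i :=
  Measurable.of_comap_le
    (le_iSup₂ (f := fun (i : ℕ) (_ : i ≤ n) => mE.comap fun w : ℕ → E => w i) i h)

theorem coordFiltration_zero :
    coordFiltration E 0 = mE.comap fun w : ℕ → E => w 0 := by
  apply le_antisymm
  · refine iSup₂_le fun i hi => ?_
    rw [Nat.le_zero.1 hi]
  · exact (measurable_coord le_rfl).comap_le

theorem coordFiltration_succ (n : ℕ) :
    coordFiltration E (n + 1) = coordFiltration E n ⊔ mE.comap fun w : ℕ → E => w (n + 1) := by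
  apply le_antisymm
  · refine iSup₂_le fun i hi => ?_
    rcases Nat.le_succ_iff.1 hi with h | rfl
    · exact (measurable_coord h).comap_le.trans le_sup_left
    · exact le_sup_right
  · exact sup_le ((coordFiltration E).mono n.le_succ) (measurable_coord le_rfl).comap_le

theorem iSup_coordFiltration :
    ⨆ n, (coordFiltration E n : MeasurableSpace (ℕ → E)) = MeasurableSpace.pi := by
  apply le_antisymm
  · exact iSup_le fun n => (coordFiltration E).le n
  · exact iSup_le fun n => (measurable_coord le_rfl).comap_le.trans
      (le_iSup (fun n => (coordFiltration E n : MeasurableSpace (ℕ → E))) n)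

theorem measurable_pathShift_coordFiltration (n j : ℕ) :
    Measurable[coordFiltration E (n + j), coordFiltration E j] (pathShift (E := E) n) := by
  rw [measurable_iff_comap_le]
  simp only [coordFiltration, MeasurableSpace.comap_iSup, MeasurableSpace.comap_comp]
  refine iSup₂_le fun i hi => ?_
  exact (measurable_coord (E := E) (i := n + i) (n := n + j) (by omega)).comap_le

/-- The measure `ν` on sequences has the Markov property with transition probabilities `q y A`,
for the sets `A` of a given family. -/
def IsMarkovLaw (S : Set (Set E)) (q : E → Set E → ℝ≥0∞) (ν : Measure (ℕ → E)) : Prop :=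
  ∀ n C, MeasurableSet[coordFiltration E n] C → ∀ A ∈ S,
    ν (C ∩ {w | w (n + 1) ∈ A}) = ∫⁻ w in C, q (w n) A ∂ν

variable {S : Set (Set E)} {q : E → Set E → ℝ≥0∞}

namespace IsMarkovLaw

/-- A Markov law is determined by its transition probabilities and initial law. -/
theorem unique {ν ν' : Measure (ℕ → E)} [IsFiniteMeasure ν] [IsFiniteMeasure ν']
    (hS : mE = MeasurableSpace.generateFrom S) (hpi : IsPiSystem S) (huniv : Set.univ ∈ S)
    (hq : ∀ A ∈ S, Measurable fun y => q y A) (hν : IsMarkovLaw S q ν) (hν' : IsMarkovLaw S q ν')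
    (h0 : ν.map (fun w => w 0) = ν'.map (fun w => w 0)) : ν = ν' := by
  have huv : ν Set.univ = ν' Set.univ := by
    have := congrArg (fun m : Measure E => m Set.univ) h0
    simpa [Measure.map_apply (measurable_pi_apply (X := fun _ : ℕ => E) 0)] using this
  have key : ∀ n, ∀ C, MeasurableSet[coordFiltration E n] C → ν C = ν' C := by
    intro n
    induction n with
    | zero =>
      intro C hC
      rw [coordFiltration_zero] at hC
      obtain ⟨A, hA, rfl⟩ := hC
      rw [← Measure.map_apply (measurable_pi_apply 0) hA,
        ← Measure.map_apply (measurable_pi_apply 0) hA, h0]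
    | succ n ih =>
      intro C hC
      -- The next σ-algebra is generated by the sets `D ∩ {w (n+1) ∈ A}` with `A ∈ S`. The Markov
      -- property expresses their mass as an integral over `D` of a function of `w n`, and there the
      -- two measures already agree.
      have hgen : (mE.comap fun w : ℕ → E => w (n + 1)) = MeasurableSpace.generateFrom
          (Set.preimage (fun w : ℕ → E => w (n + 1)) '' S) := by
        rw [hS]; exact MeasurableSpace.comap_generateFrom
      refine ext_on_measurableSpace_of_generate_finite MeasurableSpace.pi _ ?_
        ((coordFiltration E).le (n + 1))
        ((coordFiltration_succ n).trans (sup_eq_generateFrom_inter _ _ hgen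
          ⟨Set.univ, huniv, rfl⟩)) (isPiSystem_inter _ (hpi.comap _)) huv hC
      rintro _ ⟨D, _, hD, ⟨A, hA, rfl⟩, rfl⟩
      have h1 := hν n D hD A hA
      have h2 := hν' n D hD A hA
      refine h1.trans (Eq.trans ?_ h2.symm)
      exact setLIntegral_congr_of_measurableSet ((coordFiltration E).le n) ih
        ((hq A hA).comp (measurable_coord le_rfl)) hD
  refine ext_of_generate_finite {C | ∃ n, MeasurableSet[coordFiltration E n] C} ?_ ?_
    (fun C ⟨n, hC⟩ => key n C hC) huv
  · refine (iSup_coordFiltration (E := E)).symm.trans ?_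
    apply le_antisymm
    · exact iSup_le fun n C hC => MeasurableSpace.measurableSet_generateFrom ⟨n, hC⟩
    · refine MeasurableSpace.generateFrom_le ?_
      rintro C ⟨n, hC⟩
      exact le_iSup (fun n => (coordFiltration E n : MeasurableSpace (ℕ → E))) n _ hC
  · rintro C ⟨n, hC⟩ D ⟨k, hD⟩ -
    exact ⟨max n k, MeasurableSet.inter ((coordFiltration E).mono (le_max_left n k) _ hC)
      ((coordFiltration E).mono (le_max_right n k) _ hD)⟩

/-- Conditioning on an event of the first `n + 1` coordinates does not disturb the Markov property
of what follows: `C` together with an event of the shifted past is an event of the past up to time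
`n + j`. No normalisation is needed, because the defining identity is homogeneous in the measure. -/
theorem restrict_map_pathShift {ν : Measure (ℕ → E)} (hSm : ∀ A ∈ S, MeasurableSet A)
    (hq : ∀ A ∈ S, Measurable fun y => q y A) (hν : IsMarkovLaw S q ν) (n : ℕ) {C : Set (ℕ → E)}
    (hC : MeasurableSet[coordFiltration E n] C) :
    IsMarkovLaw S q ((ν.restrict C).map (pathShift n)) := by
  intro j D hD A hA
  have hDm := (coordFiltration E).le j _ hD
  have hSD : MeasurableSet[coordFiltration E (n + j)] (pathShift n ⁻¹' D ∩ C) :=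
    MeasurableSet.inter (measurable_pathShift_coordFiltration n j hD)
      ((coordFiltration E).mono (Nat.le_add_right n j) _ hC)
  have hAm : MeasurableSet {w : ℕ → E | w (j + 1) ∈ A} := measurable_pi_apply (j + 1) (hSm A hA)
  rw [Measure.map_apply (measurable_pathShift n) (hDm.inter hAm), Measure.restrict_apply
    (measurable_pathShift n (hDm.inter hAm)), Measure.restrict_map (measurable_pathShift n) hDm,
    lintegral_map (f := fun w : ℕ → E => q (w j) A) ((hq A hA).comp (measurable_pi_apply j))
      (measurable_pathShift n), Measure.restrict_restrict (measurable_pathShift n hDm)]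
  have := hν (n + j) _ hSD A hA
  refine Eq.trans ?_ this
  congr 1
  ext w
  simp only [Set.mem_inter_iff, Set.mem_preimage, Set.mem_ofPred_eq, pathShift, add_assoc]
  tauto

/-- A density in `w 0` changes the initial law only. The Markov property says that `ν` restricted to
`{w (n+1) ∈ A}` and `ν` with density `q (w n) A` agree on the past, and `g (w 0)` may be integrated
against both because it is measurable for every past. -/
theorem withDensity_coord_zero {ν : Measure (ℕ → E)} (hSm : ∀ A ∈ S, MeasurableSet A)
    (hq : ∀ A ∈ S, Measurable fun y => q y A) (hν : IsMarkovLaw S q ν) {g : E → ℝ≥0∞}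
    (hg : Measurable g) : IsMarkovLaw S q (ν.withDensity fun w => g (w 0)) := by
  intro n C hC A hA
  have hCm := (coordFiltration E).le n _ hC
  have hAm : MeasurableSet {w : ℕ → E | w (n + 1) ∈ A} := measurable_pi_apply (n + 1) (hSm A hA)
  have hg0 : Measurable fun w : ℕ → E => g (w 0) := hg.comp (measurable_pi_apply 0)
  have hqn : Measurable fun w : ℕ → E => q (w n) A := (hq A hA).comp (measurable_pi_apply n)
  rw [withDensity_apply _ (hCm.inter hAm),
    setLIntegral_withDensity_eq_setLIntegral_mul _ hg0 hqn hCm]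
  have h := setLIntegral_congr_of_measurableSet ((coordFiltration E).le n)
    (ν := ν.restrict {w | w (n + 1) ∈ A}) (ν' := ν.withDensity fun w => q (w n) A)
    (f := fun w => g (w 0)) (fun D hD => by
      have hDm := (coordFiltration E).le n _ hD
      rw [Measure.restrict_apply hDm, withDensity_apply _ hDm]
      exact hν n D hD A hA) (hg.comp (measurable_coord (Nat.zero_le n))) hC
  rw [Measure.restrict_restrict hCm, setLIntegral_withDensity_eq_setLIntegral_mul _ hqn hg0 hCm]
    at h
  rw [h]
  simp only [Pi.mul_apply, mul_comm]

variable {ν : Measure (ℕ → E)} [IsProbabilityMeasure ν]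

/-- A Markov law is shift invariant as soon as the first two coordinates have the same law. -/
theorem measurePreserving_pathShift
    (hS : mE = MeasurableSpace.generateFrom S) (hpi : IsPiSystem S) (huniv : Set.univ ∈ S)
    (hq : ∀ A ∈ S, Measurable fun y => q y A) (hν : IsMarkovLaw S q ν)
    (hst : ν.map (fun w => w 1) = ν.map (fun w => w 0)) :
    MeasurePreserving (pathShift 1) ν ν := by
  have hSm : ∀ A ∈ S, MeasurableSet A := fun A hA => by
    rw [hS]; exact MeasurableSpace.measurableSet_generateFrom hA
  refine ⟨measurable_pathShift 1, ?_⟩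
  have h := hν.restrict_map_pathShift hSm hq 1 (C := Set.univ) MeasurableSet.univ
  rw [Measure.restrict_univ] at h
  refine h.unique hS hpi huniv hq hν ?_
  rw [Measure.map_map (measurable_pi_apply 0) (measurable_pathShift 1)]
  exact hst

/-- Given an event, the conditional probability of a shift invariant event given the first `n + 1`
coordinates is a function of the last of them, the same for all `n`. -/
theorem measure_inter_of_invariant
    (hS : mE = MeasurableSpace.generateFrom S) (hpi : IsPiSystem S) (huniv : Set.univ ∈ S)
    (hq : ∀ A ∈ S, Measurable fun y => q y A) (hν : IsMarkovLaw S q ν)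
    (hst : ν.map (fun w => w 1) = ν.map (fun w => w 0))
    {B : Set (ℕ → E)} (hB : MeasurableSet B) (hinv : pathShift 1 ⁻¹' B = B) (n : ℕ)
    {C : Set (ℕ → E)} (hC : MeasurableSet[coordFiltration E n] C) :
    ν (C ∩ B) = ∫⁻ w in C,
      ((ν.restrict B).map (fun w => w 0)).rnDeriv (ν.map fun w => w 0) (w n) ∂ν := by
  have hSm : ∀ A ∈ S, MeasurableSet A := fun A hA => by
    rw [hS]; exact MeasurableSpace.measurableSet_generateFrom hA
  have hm : ∀ i, Measurable fun w : ℕ → E => w i := fun i => measurable_pi_apply i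
  have hCm := (coordFiltration E).le n _ hC
  have hmp := hν.measurePreserving_pathShift hS hpi huniv hq hst
  have hmpn : MeasurePreserving (pathShift n) ν ν := by
    rw [← iterate_pathShift_one]; exact hmp.iterate n
  have hstn : ν.map (fun w => w n) = ν.map (fun w => w 0) := by
    conv_rhs => rw [← hmpn.map_eq]
    rw [Measure.map_map (hm 0) (measurable_pathShift n)]
    rfl
  set π := ν.map fun w => w 0 with hπ
  have : IsProbabilityMeasure π := Measure.isProbabilityMeasure_map (hm 0).aemeasurable
  set h := ((ν.restrict B).map (fun w => w 0)).rnDeriv π with hh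
  have hhm : Measurable h := Measure.measurable_rnDeriv _ _
  have hhd : π.withDensity h = (ν.restrict B).map (fun w => w 0) :=
    Measure.withDensity_rnDeriv_eq _ _
      (Measure.absolutelyContinuous_of_le (Measure.map_mono Measure.restrict_le_self (hm 0)))
  -- The density `g` of the law of `w n` on `C` is the weight on initial states for which the chain
  -- started with density `g` imitates the chain seen from time `n` on the event `C`.
  set πC := (ν.restrict C).map (fun w => w n) with hπC
  have hπCle : πC ≤ π := hstn ▸ Measure.map_mono Measure.restrict_le_self (hm n)
  set g := πC.rnDeriv π with hg
  have hgm : Measurable g := Measure.measurable_rnDeriv _ _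
  have hgd : π.withDensity g = πC :=
    Measure.withDensity_rnDeriv_eq _ _ (Measure.absolutelyContinuous_of_le hπCle)
  have hg0 : Measurable fun w : ℕ → E => g (w 0) := hgm.comp (hm 0)
  have hmapd : (ν.withDensity fun w => g (w 0)).map (fun w => w 0) = π.withDensity g := by
    ext A hA
    rw [Measure.map_apply (hm 0) hA, withDensity_apply _ (hm 0 hA), withDensity_apply _ hA,
      Measure.restrict_map (hm 0) hA, lintegral_map hgm (hm 0)]
  have : IsFiniteMeasure (ν.withDensity fun w => g (w 0)) := by
    refine ⟨?_⟩
    have h1 := congrArg (fun m : Measure E => m Set.univ) (hmapd.trans hgd)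
    simp only [Measure.map_apply (hm 0) MeasurableSet.univ, Set.preimage_univ] at h1
    rw [h1]; exact measure_lt_top _ _
  -- Two Markov laws with the same transitions and the same initial law: the future after `n`
  -- remembers `C` only through the law of `w n`.
  have huni : (ν.restrict C).map (pathShift n) = ν.withDensity fun w => g (w 0) := by
    refine (hν.restrict_map_pathShift hSm hq n hC).unique hS hpi huniv hq
      (hν.withDensity_coord_zero hSm hq hgm) ?_
    rw [hmapd, hgd, Measure.map_map (hm 0) (measurable_pathShift n)]
    rfl
  have hinvn : pathShift n ⁻¹' B = B := by
    rw [← iterate_pathShift_one]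
    exact Function.IsFixedPt.preimage_iterate hinv n
  -- Invariance lets `B` be tested on the shifted path, where the mass is `∫ g h dπ`. This is
  -- symmetric in `g` and `h`, and reading it the other way gives the integral of `h (w n)` over
  -- `C`.
  calc ν (C ∩ B) = ((ν.restrict C).map (pathShift n)) B := by
        rw [Measure.map_apply (measurable_pathShift n) hB, hinvn, Measure.restrict_apply hB,
          Set.inter_comm]
    _ = ∫⁻ w in B, g (w 0) ∂ν := by rw [huni, withDensity_apply _ hB]
    _ = ∫⁻ y, g y ∂(π.withDensity h) := by rw [hhd, lintegral_map hgm (hm 0)]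
    _ = ∫⁻ y, h y ∂(π.withDensity g) := by
        rw [lintegral_withDensity_eq_lintegral_mul _ hhm hgm,
          lintegral_withDensity_eq_lintegral_mul _ hgm hhm, mul_comm]
    _ = ∫⁻ w in C, h (w n) ∂ν := by rw [hgd, lintegral_map hhm (hm n)]

/-- A stationary Markov law is ergodic under the shift if the state space has no nontrivial set of
states which the process neither enters nor leaves. -/
theorem ergodic_pathShift
    (hS : mE = MeasurableSpace.generateFrom S) (hpi : IsPiSystem S) (huniv : Set.univ ∈ S)
    (hq : ∀ A ∈ S, Measurable fun y => q y A) (hν : IsMarkovLaw S q ν)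
    (hst : ν.map (fun w => w 1) = ν.map (fun w => w 0))
    (htriv : ∀ A, MeasurableSet A → (∀ n, {w : ℕ → E | w n ∈ A} =ᵐ[ν] {w | w 0 ∈ A}) →
      ν {w | w 0 ∈ A} = 0 ∨ ν {w | w 0 ∈ A} = 1) :
    Ergodic (pathShift 1) ν := by
  have hmp := hν.measurePreserving_pathShift hS hpi huniv hq hst
  refine ⟨hmp, ⟨fun B hB hinv => ?_⟩⟩
  have hm : ∀ i, Measurable fun w : ℕ → E => w i := fun i => measurable_pi_apply i
  have hmpn : ∀ n, MeasurePreserving (pathShift n) ν ν := fun n => by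
    rw [← iterate_pathShift_one]; exact hmp.iterate n
  have hinvn : ∀ n, pathShift n ⁻¹' B = B := fun n => by
    rw [← iterate_pathShift_one]
    exact Function.IsFixedPt.preimage_iterate hinv n
  have hcond : ∀ n C, MeasurableSet[coordFiltration E n] C → _ := fun n C hC =>
    hν.measure_inter_of_invariant hS hpi huniv hq hst hB hinv n hC
  set h := ((ν.restrict B).map (fun w => w 0)).rnDeriv (ν.map fun w => w 0) with hh
  have hhm : Measurable h := Measure.measurable_rnDeriv _ _
  have hhn : ∀ n, Measurable fun w : ℕ → E => h (w n) := fun n => hhm.comp (hm n)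
  have hhtop : ∀ n, ∀ᵐ w ∂ν, h (w n) < ∞ := by
    intro n
    refine ae_lt_top (hhm.comp (hm n)) ?_
    have := hcond n Set.univ MeasurableSet.univ
    rw [Measure.restrict_univ] at this
    rw [← this]
    exact measure_ne_top _ _
  have hr0 : ∀ n, Integrable (fun w : ℕ → E => (h (w n)).toReal) ν := by
    intro n
    refine integrable_toReal_of_lintegral_ne_top (hhm.comp (hm n)).aemeasurable ?_
    have := hcond n Set.univ MeasurableSet.univ
    rw [Measure.restrict_univ] at this
    rw [← this]
    exact measure_ne_top _ _
  have hBi : Integrable (B.indicator fun _ => (1 : ℝ)) ν := (integrable_const 1).indicator hB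
  have hce : ∀ n, (fun w : ℕ → E => (h (w n)).toReal) =ᵐ[ν]
      ν[B.indicator fun _ => (1 : ℝ) | coordFiltration E n] := by
    intro n
    refine ae_eq_condExp_of_forall_setIntegral_eq ((coordFiltration E).le n) hBi
      (fun C _ _ => (hr0 n).integrableOn) (fun C hC _ => ?_)
      (hhm.comp (measurable_coord le_rfl)).ennreal_toReal.aestronglyMeasurable
    rw [integral_toReal (hhn n).aemeasurable (ae_restrict_of_ae (hhtop n)),
      ← hcond n C hC, setIntegral_indicator hB, setIntegral_const, smul_eq_mul, mul_one]
    rfl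
  -- Lévy's upward theorem: the coordinates generate the whole σ-algebra, so the conditional
  -- probabilities of `B` converge to its indicator.
  have hlim : ∀ᵐ w ∂ν, Tendsto (fun n => (h (w n)).toReal) atTop
      (𝓝 (B.indicator (fun _ => (1 : ℝ)) w)) := by
    have h1 := tendsto_ae_condExp (ℱ := coordFiltration E) (μ := ν)
      (B.indicator fun _ => (1 : ℝ))
    rw [iSup_coordFiltration, condExp_of_stronglyMeasurable le_rfl
      (stronglyMeasurable_const.indicator hB) hBi] at h1
    filter_upwards [h1, ae_all_iff.2 hce] with w hw1 hw2
    exact hw1.congr fun n => (hw2 n).symm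
  -- A bounded continuous function, nonnegative and vanishing exactly at `0` and `1`. The integral
  -- of `ψ (h (w n))` tends to `0` because the limit of `h (w n)` is an indicator, yet by
  -- stationarity it does not depend on `n`. Hence `h (w 0)` already lies in `{0, 1}`.
  let ψ : ℝ → ℝ := fun t => min 1 |t * (1 - t)|
  have hψc : Continuous ψ := by fun_prop
  have hψ0 : ∀ t, 0 ≤ ψ t := fun t => le_min zero_le_one (abs_nonneg _)
  have hψ1 : ∀ t, ‖ψ t‖ ≤ 1 := fun t => by
    rw [Real.norm_eq_abs, abs_of_nonneg (hψ0 t)]; exact min_le_left _ _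
  have hψm : ∀ n, Measurable fun w : ℕ → E => ψ (h (w n)).toReal := fun n =>
    hψc.measurable.comp (hhm.comp (hm n)).ennreal_toReal
  have hlimψ : Tendsto (fun n => ∫ w, ψ (h (w n)).toReal ∂ν) atTop (𝓝 (∫ _, 0 ∂ν)) := by
    refine tendsto_integral_of_dominated_convergence (fun _ => 1)
      (fun n => (hψm n).aestronglyMeasurable) (integrable_const _)
      (fun n => ae_of_all _ fun w => hψ1 _) ?_
    filter_upwards [hlim] with w hw
    have h1 := (hψc.tendsto _).comp hw
    have h2 : ψ (B.indicator (fun _ => (1 : ℝ)) w) = 0 := by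
      by_cases hwB : w ∈ B <;> simp [ψ, hwB]
    rwa [h2] at h1
  have hconst : ∀ n, ∫ w, ψ (h (w n)).toReal ∂ν = ∫ w, ψ (h (w 0)).toReal ∂ν := by
    intro n
    conv_rhs => rw [← (hmpn n).map_eq]
    rw [integral_map (hmpn n).measurable.aemeasurable (hψm 0).aestronglyMeasurable]
    rfl
  have hψae : ∀ᵐ w ∂ν, ψ (h (w 0)).toReal = 0 := by
    have h1 : ∫ w, ψ (h (w 0)).toReal ∂ν = 0 := by
      simp only [hconst, integral_zero] at hlimψ
      exact tendsto_nhds_unique tendsto_const_nhds hlimψ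
    exact (integral_eq_zero_iff_of_nonneg (fun w => hψ0 _)
      (Integrable.of_bound (hψm 0).aestronglyMeasurable 1 (ae_of_all _ fun w => hψ1 _))).1 h1
  have h01 : ∀ᵐ w ∂ν, h (w 0) = 0 ∨ h (w 0) = 1 := by
    filter_upwards [hψae, hhtop 0] with w hw hwt
    have h1 : (h (w 0)).toReal * (1 - (h (w 0)).toReal) = 0 := by
      rcases min_choice 1 |(h (w 0)).toReal * (1 - (h (w 0)).toReal)| with h2 | h2
      · rw [show ψ _ = _ from h2] at hw; norm_num at hw
      · rw [show ψ _ = _ from h2] at hw; exact abs_eq_zero.1 hw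
    rcases mul_eq_zero.1 h1 with h2 | h2
    · left; exact (ENNReal.toReal_eq_zero_iff _).1 h2 |>.resolve_right hwt.ne
    · right; exact (ENNReal.toReal_eq_one_iff _).1 (sub_eq_zero.1 h2).symm
  set A : Set E := {y | h y = 1} with hA
  have hAm : MeasurableSet A := hhm (measurableSet_singleton 1)
  have hA0 : MeasurableSet {w : ℕ → E | w 0 ∈ A} := hm 0 hAm
  have hAF : MeasurableSet[coordFiltration E 0] {w : ℕ → E | w 0 ∈ A} :=
    measurable_coord le_rfl hAm
  have e1 : ν ({w : ℕ → E | w 0 ∈ A} ∩ B) = ν {w | w 0 ∈ A} := by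
    rw [hcond 0 _ hAF, setLIntegral_congr_fun (g := fun _ => 1) hA0 (fun w hw => hw)]
    simp
  have e2 : ν ({w : ℕ → E | w 0 ∈ A}ᶜ ∩ B) = 0 := by
    rw [hcond 0 _ hAF.compl, lintegral_eq_zero_iff (hhn 0)]
    filter_upwards [ae_restrict_of_ae h01, ae_restrict_mem hA0.compl] with w hw1 hw2
    exact hw1.resolve_right hw2
  have hBA : {w : ℕ → E | w 0 ∈ A} =ᵐ[ν] B := by
    have e3 : ν ({w : ℕ → E | w 0 ∈ A} \ B) = 0 := by
      have := measure_inter_add_sdiff (μ := ν) {w : ℕ → E | w 0 ∈ A} hB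
      rw [e1] at this
      exact (ENNReal.add_right_inj (measure_ne_top ν {w : ℕ → E | w 0 ∈ A})).1
        (this.trans (add_zero _).symm)
    have e4 : ν (B \ {w : ℕ → E | w 0 ∈ A}) = 0 := by
      rw [Set.sdiff_eq, Set.inter_comm]; exact e2
    exact (ae_le_set.2 e3).antisymm (ae_le_set.2 e4)
  have hBAn : ∀ n, {w : ℕ → E | w n ∈ A} =ᵐ[ν] {w | w 0 ∈ A} := by
    intro n
    have := (hmpn n).quasiMeasurePreserving.preimage_ae_eq hBA
    rw [hinvn n] at this
    exact this.trans hBA.symm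
  rw [eventuallyConst_set']
  rcases htriv A hAm hBAn with h0 | h1
  · left; exact hBA.symm.trans (ae_eq_empty.2 h0)
  · right; exact hBA.symm.trans ((ae_eq_univ_iff_measure_eq hA0.nullMeasurableSet).2
      (by rw [h1, measure_univ]))

end IsMarkovLaw

end MarkovSequences

namespace RandomDynSys

variable {𝕋 : Type*} [AddMonoidWithOne 𝕋] {Ω : Type*} {mΩ : MeasurableSpace Ω} {P : Measure Ω}
  {M : Type*} [mM : MeasurableSpace M] {N : Type*} [mN : MeasurableSpace N]

/-! ### The one-point motions -/

theorem measurable_T_apply (Φ : RandomDynSys 𝕋 P M) (t : 𝕋) (x : M) :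
    Measurable fun ω => Φ.T t ω x :=
  (Φ.measurable_T t).comp measurable_prodMk_right

theorem measurable_T_swap (Φ : RandomDynSys 𝕋 P M) (t : 𝕋) :
    Measurable fun p : M × Ω => Φ.T t p.2 p.1 :=
  (Φ.measurable_T t).comp measurable_swap

theorem measurable_transition [SFinite P] (Φ : RandomDynSys 𝕋 P M) (t : 𝕋) {A : Set M}
    (hA : MeasurableSet A) : Measurable fun y => P {ω | Φ.T t ω y ∈ A} :=
  measurable_measure_prodMk_left (Φ.measurable_T_swap t hA)

/-- The dynamics algebra contains the events of all one-point motions. -/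
theorem measurable_T_dynamicsAlgebra (Φ : RandomDynSys 𝕋 P M) (n : ℕ) (x : M) :
    Measurable[Φ.dynamicsAlgebra] fun ω => Φ.T (n : 𝕋) ω x := by
  have h : (mM.comap fun ω => Φ.T (n : 𝕋) (Φ.θ ((0 : ℕ) : 𝕋) ω) x) ≤ Φ.dynamicsAlgebra :=
    le_iSup_of_le 0 (le_iSup_of_le n (le_iSup_of_le x le_rfl))
  rw [Nat.cast_zero, Φ.θ_zero] at h
  exact Measurable.of_comap_le h

theorem dynamicsAlgebra_le (Φ : RandomDynSys 𝕋 P M) : Φ.dynamicsAlgebra ≤ mΩ :=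
  iSup_le fun t => iSup_le fun n => iSup_le fun x =>
    ((Φ.measurable_T_apply n x).comp (Φ.measurePreserving_θ t).measurable).comap_le

/-- The Markov property, integrated over an event of the past. -/
theorem IsMarkovFamily.measure_inter [IsProbabilityMeasure P] {Φ : RandomDynSys 𝕋 P M}
    (h : Φ.IsMarkovFamily) (x : M) (s t : ℕ) {A : Set M} (hA : MeasurableSet A) {D : Set Ω}
    (hD : MeasurableSet[⨆ r : Fin (t + 1), mM.comap fun ω => Φ.T ((r : ℕ) : 𝕋) ω x] D) :
    P (D ∩ {ω | Φ.T ((t + s : ℕ) : 𝕋) ω x ∈ A}) =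
      ∫⁻ ω in D, P {ω' | Φ.T (s : 𝕋) ω' (Φ.T (t : 𝕋) ω x) ∈ A} ∂P := by
  have hle : (⨆ r : Fin (t + 1), mM.comap fun ω => Φ.T ((r : ℕ) : 𝕋) ω x) ≤ mΩ :=
    iSup_le fun r => (Φ.measurable_T_apply _ x).comap_le
  have hE : MeasurableSet {ω | Φ.T ((t + s : ℕ) : 𝕋) ω x ∈ A} := Φ.measurable_T_apply _ x hA
  have hp : Measurable fun ω => P {ω' | Φ.T (s : 𝕋) ω' (Φ.T (t : 𝕋) ω x) ∈ A} :=
    (Φ.measurable_transition (s : 𝕋) hA).comp (Φ.measurable_T_apply (t : 𝕋) x)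
  have h1 := setIntegral_condExp hle
    ((integrable_const (μ := P) (1 : ℝ)).indicator hE) hD
  rw [setIntegral_congr_ae (g := fun ω => P.real {ω' | Φ.T (s : 𝕋) ω' (Φ.T (t : 𝕋) ω x) ∈ A})
    (hle _ hD) ((h x s t A hA).mono fun ω hω _ => hω), setIntegral_indicator hE,
    setIntegral_const, smul_eq_mul, mul_one] at h1
  simp only [Measure.real] at h1
  rw [integral_toReal hp.aemeasurable (ae_of_all _ fun ω => measure_lt_top _ _)] at h1
  refine ((ENNReal.toReal_eq_toReal_iff' ?_ (measure_ne_top _ _)).1 h1).symm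
  refine ne_top_of_le_ne_top ENNReal.one_ne_top ?_
  calc ∫⁻ ω in D, P {ω' | Φ.T (s : 𝕋) ω' (Φ.T (t : 𝕋) ω x) ∈ A} ∂P
      ≤ ∫⁻ _ in D, 1 ∂P := lintegral_mono fun ω => prob_le_one
    _ ≤ 1 := by rw [setLIntegral_one]; exact prob_le_one

/-- An invariant measure is the law of every `T n ω x`, for `(x, ω)` of law `μ × P`. -/
theorem IsInvariantMeasure.measurePreserving [IsProbabilityMeasure P] {Φ : RandomDynSys 𝕋 P M}
    {μ : Measure M} [IsProbabilityMeasure μ] (h : Φ.IsInvariantMeasure μ) (n : ℕ) :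
    MeasurePreserving (fun p : M × Ω => Φ.T (n : 𝕋) p.2 p.1) (μ.prod P) μ := by
  refine ⟨Φ.measurable_T_swap _, ?_⟩
  ext A hA
  rw [Measure.map_apply (Φ.measurable_T_swap _) hA,
    Measure.prod_apply_symm (Φ.measurable_T_swap _ hA)]
  exact h n A hA

/-! ### Independent noise -/

/-- The noise variables `ξ t` are i.i.d. and, as a process, independent of the dynamics. -/
structure IsIIDNoise (Φ : RandomDynSys 𝕋 P M) (ξ : ℕ → Ω → N) : Prop where
  measurable : ∀ t, Measurable (ξ t)
  map_eq : ∀ t, P.map (ξ t) = P.map (ξ 0)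
  iIndep : iIndep (fun t => mN.comap (ξ t)) P
  indep : Indep (⨆ t, mN.comap (ξ t)) Φ.dynamicsAlgebra P

namespace IsIIDNoise

variable {Φ : RandomDynSys 𝕋 P M} {ξ : ℕ → Ω → N}

theorem measure_preimage (h : Φ.IsIIDNoise ξ) (t : ℕ) {U : Set N} (hU : MeasurableSet U) :
    P (ξ t ⁻¹' U) = P.map (ξ 0) U := by
  rw [← h.map_eq t, Measure.map_apply (h.measurable t) hU]

theorem measure_inter (h : Φ.IsIIDNoise ξ) {D V : Set Ω} (hD : MeasurableSet[Φ.dynamicsAlgebra] D)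
    {T : Set ℕ} (hV : MeasurableSet[⨆ i ∈ T, mN.comap (ξ i)] V) {s : ℕ} (hs : s ∉ T)
    {U : Set N} (hU : MeasurableSet U) :
    P (D ∩ V ∩ ξ s ⁻¹' U) = P D * P V * P.map (ξ 0) U := by
  have hU' : MeasurableSet[⨆ i ∈ ({s} : Set ℕ), mN.comap (ξ i)] (ξ s ⁻¹' U) :=
    le_iSup₂ (f := fun i (_ : i ∈ ({s} : Set ℕ)) => mN.comap (ξ i)) s rfl _ ⟨U, hU, rfl⟩
  have h1 := (Indep_iff _ _ _).1 (indep_iSup_of_disjoint (fun t => (h.measurable t).comap_le)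
    h.iIndep (Set.disjoint_singleton_right.2 hs)) _ _ hV hU'
  have hle : ∀ T : Set ℕ, (⨆ i ∈ T, mN.comap (ξ i)) ≤ ⨆ t, mN.comap (ξ t) := fun T =>
    iSup₂_le fun i _ => le_iSup (fun t => mN.comap (ξ t)) i
  have h2 := (Indep_iff _ _ _).1 h.indep _ _
    (MeasurableSet.inter (hle _ _ hV) (hle _ _ hU')) hD
  rw [h1, h.measure_preimage s hU] at h2
  rw [Set.inter_assoc, Set.inter_comm, h2]
  ring

end IsIIDNoise

/-- The sequence of the states and noise variables along the trajectory of `(x, ω)`. -/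
def noisyPath (Φ : RandomDynSys 𝕋 P M) (ξ : ℕ → Ω → N) (p : M × Ω) (t : ℕ) : M × N :=
  (Φ.T (t : 𝕋) p.2 p.1, ξ t p.2)

theorem measurable_noisyPath (Φ : RandomDynSys 𝕋 P M) {ξ : ℕ → Ω → N}
    (hξ : ∀ t, Measurable (ξ t)) : Measurable (Φ.noisyPath ξ) :=
  measurable_pi_lambda _ fun t =>
    (Φ.measurable_T_swap (t : 𝕋)).prodMk ((hξ t).comp measurable_snd)

/-- The transition probabilities of the process of states and noise variables. -/
def noisyTransition (Φ : RandomDynSys 𝕋 P M) (η : Measure N) (y : M × N) (B : Set (M × N)) :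
    ℝ≥0∞ :=
  (P.prod η) {z | (Φ.T ((1 : ℕ) : 𝕋) z.1 y.1, z.2) ∈ B}

theorem measurable_noisyTransition [SFinite P] (Φ : RandomDynSys 𝕋 P M) (η : Measure N)
    [SFinite η] {B : Set (M × N)} (hB : MeasurableSet B) :
    Measurable fun y => Φ.noisyTransition η y B := by
  refine measurable_measure_prodMk_left (ν := P.prod η)
    (s := {p : (M × N) × (Ω × N) | (Φ.T ((1 : ℕ) : 𝕋) p.2.1 p.1.1, p.2.2) ∈ B}) ?_
  have : Measurable fun p : (M × N) × (Ω × N) => (Φ.T ((1 : ℕ) : 𝕋) p.2.1 p.1.1, p.2.2) :=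
    ((Φ.measurable_T ((1 : ℕ) : 𝕋)).comp
      ((measurable_fst.comp measurable_snd).prodMk (measurable_fst.comp measurable_fst))).prodMk
      (measurable_snd.comp measurable_snd)
  exact this hB

theorem noisyTransition_prod [SFinite P] (Φ : RandomDynSys 𝕋 P M) (η : Measure N) [SFinite η]
    (y : M × N) (A : Set M) (U : Set N) :
    Φ.noisyTransition η y (A ×ˢ U) = P {ω | Φ.T ((1 : ℕ) : 𝕋) ω y.1 ∈ A} * η U := by
  rw [← Measure.prod_prod]
  rfl

/-- The measurable rectangles. -/
def rectangles (M N : Type*) [MeasurableSpace M] [MeasurableSpace N] : Set (Set (M × N)) :=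
  Set.image2 (· ×ˢ ·) {A | MeasurableSet A} {U | MeasurableSet U}

variable [IsProbabilityMeasure P] {Φ : RandomDynSys 𝕋 P M} {ξ : ℕ → Ω → N}

/-- The Markov property of the states and noise variables, integrated over an event determined by
the past of the motion and of the noise. -/
theorem IsIIDNoise.measure_inter_past (hΦ : Φ.IsMarkovFamily) (hξ : Φ.IsIIDNoise ξ) (x : M)
    (n : ℕ) {A : Set M} (hA : MeasurableSet A) {U : Set N} (hU : MeasurableSet U) {D : Set Ω}
    (hD : MeasurableSet[(⨆ r : Fin (n + 1), mM.comap fun ω => Φ.T ((r : ℕ) : 𝕋) ω x) ⊔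
      ⨆ i ∈ Set.Iic n, mN.comap (ξ i)] D) :
    P (D ∩ ({ω | Φ.T ((n + 1 : ℕ) : 𝕋) ω x ∈ A} ∩ ξ (n + 1) ⁻¹' U)) =
      ∫⁻ ω in D, P {ω' | Φ.T ((1 : ℕ) : 𝕋) ω' (Φ.T (n : 𝕋) ω x) ∈ A} * P.map (ξ 0) U ∂P := by
  have hp : Measurable fun ω => P {ω' | Φ.T ((1 : ℕ) : 𝕋) ω' (Φ.T (n : 𝕋) ω x) ∈ A} :=
    (Φ.measurable_transition ((1 : ℕ) : 𝕋) hA).comp (Φ.measurable_T_apply (n : 𝕋) x)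
  set m₁ : MeasurableSpace Ω := ⨆ r : Fin (n + 1), mM.comap fun ω => Φ.T ((r : ℕ) : 𝕋) ω x
  set m₂ : MeasurableSpace Ω := ⨆ i ∈ Set.Iic n, mN.comap (ξ i)
  have hm₁d : m₁ ≤ Φ.dynamicsAlgebra :=
    iSup_le fun r => (Φ.measurable_T_dynamicsAlgebra r x).comap_le
  have hm₁ : m₁ ≤ mΩ := hm₁d.trans Φ.dynamicsAlgebra_le
  have hm₂s : m₂ ≤ ⨆ t, mN.comap (ξ t) :=
    iSup₂_le fun i _ => le_iSup (fun t => mN.comap (ξ t)) i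
  have hm₂ : m₂ ≤ mΩ := iSup₂_le fun i _ => (hξ.measurable i).comap_le
  have hp₁ : Measurable[m₁] fun ω => P {ω' | Φ.T ((1 : ℕ) : 𝕋) ω' (Φ.T (n : 𝕋) ω x) ∈ A} := by
    have h1 : Measurable[m₁] fun ω => Φ.T (n : 𝕋) ω x :=
      Measurable.of_comap_le (le_iSup (fun r : Fin (n + 1) =>
          mM.comap fun ω => Φ.T ((r : ℕ) : 𝕋) ω x) ⟨n, by omega⟩)
    exact (Φ.measurable_transition ((1 : ℕ) : 𝕋) hA).comp h1
  have hDm : MeasurableSet[mΩ] D := (sup_le hm₁ hm₂) _ hD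
  rw [← Measure.restrict_apply hDm, ← withDensity_apply _ hDm]
  -- It suffices to treat `D₁ ∩ D₂`, with `D₁` an event of the motion and `D₂` one of the past
  -- noise. The noise at time `n + 1` then splits off by independence, and the Markov property of
  -- the motion handles `D₁`.
  refine measure_eq_of_inter_eq hm₁ hm₂ (fun D₁ D₂ hD₁ hD₂ => ?_) hD
  have hDm : MeasurableSet[mΩ] (D₁ ∩ D₂) := MeasurableSet.inter (hm₁ _ hD₁) (hm₂ _ hD₂)
  rw [Measure.restrict_apply hDm, withDensity_apply _ hDm, lintegral_mul_const _ hp]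
  have e1 : D₁ ∩ D₂ ∩ ({ω | Φ.T ((n + 1 : ℕ) : 𝕋) ω x ∈ A} ∩ ξ (n + 1) ⁻¹' U) =
      D₁ ∩ {ω | Φ.T ((n + 1 : ℕ) : 𝕋) ω x ∈ A} ∩ D₂ ∩ ξ (n + 1) ⁻¹' U := by
    ext ω; simp only [Set.mem_inter_iff]; tauto
  have hXd : MeasurableSet[Φ.dynamicsAlgebra] {ω | Φ.T ((n + 1 : ℕ) : 𝕋) ω x ∈ A} :=
    Φ.measurable_T_dynamicsAlgebra (n + 1) x hA
  rw [e1, hξ.measure_inter (MeasurableSet.inter (hm₁d _ hD₁) hXd) hD₂ (by simp) hU,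
    hΦ.measure_inter x 1 n hA hD₁]
  congr 1
  -- The factor `P D₂` goes back under the integral, since `D₂` is independent of the motion and
  -- hence of the transition probability.
  have hind : IndepSets {s | MeasurableSet[m₁] s} {D₂} P := by
    rw [IndepSets_iff]
    rintro s _ hs rfl
    rw [Set.inter_comm, (Indep_iff _ _ _).1 hξ.indep _ _ (hm₂s _ hD₂) (hm₁d _ hs), mul_comm]
  have h2 := lintegral_mul_indicator_eq_lintegral_mul_lintegral_indicator hm₁ 1 (hm₂ _ hD₂) hind
    (hp₁.indicator hD₁)
  rw [lintegral_indicator_const (hm₂ _ hD₂), one_mul, lintegral_indicator (hm₁ _ hD₁)] at h2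
  rw [← h2, ← lintegral_indicator hDm]
  refine lintegral_congr fun ω => ?_
  by_cases h1 : ω ∈ D₁ <;> by_cases h2 : ω ∈ D₂ <;> simp [h1, h2]

/-- The Markov hypothesis concerns deterministic initial states, so `x` is fixed here. Only
rectangles are tested, because on them the transition probability is a product. -/
theorem isMarkovLaw_noisyPath_apply (hΦ : Φ.IsMarkovFamily) (hξ : Φ.IsIIDNoise ξ) (x : M) :
    IsMarkovLaw (rectangles M N) (Φ.noisyTransition (P.map (ξ 0)))
      (P.map fun ω => Φ.noisyPath ξ (x, ω)) := by
  rintro n C hC _ ⟨A, hA, U, hU, rfl⟩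
  have hη : IsProbabilityMeasure (P.map (ξ 0)) :=
    Measure.isProbabilityMeasure_map (hξ.measurable 0).aemeasurable
  have hpm : Measurable fun ω => Φ.noisyPath ξ (x, ω) :=
    (Φ.measurable_noisyPath hξ.measurable).comp measurable_prodMk_left
  have hCm := (coordFiltration (M × N)).le n _ hC
  have hAU : MeasurableSet (A ×ˢ U) := MeasurableSet.prod hA hU
  have hAn : MeasurableSet {w : ℕ → M × N | w (n + 1) ∈ A ×ˢ U} := measurable_pi_apply (n + 1) hAU
  beta_reduce
  rw [Measure.map_apply hpm (hCm.inter hAn),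
    Measure.restrict_map hpm hCm, lintegral_map
      (f := fun w : ℕ → M × N => Φ.noisyTransition (P.map (ξ 0)) (w n) (A ×ˢ U))
      ((Φ.measurable_noisyTransition _ hAU).comp (measurable_pi_apply n)) hpm]
  simp only [noisyTransition_prod]
  refine hξ.measure_inter_past hΦ x n hA hU (D := (fun ω => Φ.noisyPath ξ (x, ω)) ⁻¹' C) ?_
  set m₁ : MeasurableSpace Ω := ⨆ r : Fin (n + 1), mM.comap fun ω => Φ.T ((r : ℕ) : 𝕋) ω x
  set m₂ : MeasurableSpace Ω := ⨆ i ∈ Set.Iic n, mN.comap (ξ i)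
  have : Measurable[m₁ ⊔ m₂, coordFiltration (M × N) n] fun ω => Φ.noisyPath ξ (x, ω) := by
    rw [measurable_iff_comap_le]
    simp only [coordFiltration, MeasurableSpace.comap_iSup, MeasurableSpace.comap_comp]
    refine iSup₂_le fun i hi => ?_
    have h1 : Measurable[m₁ ⊔ m₂] fun ω => Φ.T (i : 𝕋) ω x :=
      Measurable.of_comap_le ((le_iSup (fun r : Fin (n + 1) =>
        mM.comap fun ω => Φ.T ((r : ℕ) : 𝕋) ω x) ⟨i, by omega⟩).trans le_sup_left)
    have h2 : Measurable[m₁ ⊔ m₂] (ξ i) :=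
      Measurable.of_comap_le ((le_iSup₂ (f := fun i (_ : i ∈ Set.Iic n) => mN.comap (ξ i))
        i hi).trans le_sup_right)
    exact (h1.prodMk h2).comap_le
  exact this hC

variable {μ : Measure M}

/-- The law of the process of states and noise variables, for `(x, ω)` of law `μ × P`. -/
def noisyPathLaw (Φ : RandomDynSys 𝕋 P M) (ξ : ℕ → Ω → N) (μ : Measure M) :
    Measure (ℕ → M × N) :=
  (μ.prod P).map (Φ.noisyPath ξ)

/-- A mixture of Markov laws with common transition probabilities is again one, the defining
identity being linear in the measure. -/
theorem isMarkovLaw_noisyPathLaw (hΦ : Φ.IsMarkovFamily) (hξ : Φ.IsIIDNoise ξ) :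
    IsMarkovLaw (rectangles M N) (Φ.noisyTransition (P.map (ξ 0))) (Φ.noisyPathLaw ξ μ) := by
  intro n C hC B hB
  have hη : IsProbabilityMeasure (P.map (ξ 0)) :=
    Measure.isProbabilityMeasure_map (hξ.measurable 0).aemeasurable
  have hm := Φ.measurable_noisyPath hξ.measurable
  have hpm : ∀ x, Measurable fun ω => Φ.noisyPath ξ (x, ω) := fun x =>
    hm.comp measurable_prodMk_left
  have hCm := (coordFiltration (M × N)).le n _ hC
  have hBm : MeasurableSet B := by
    obtain ⟨A, hA, U, hU, rfl⟩ := hB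
    exact MeasurableSet.prod hA hU
  have hBn : MeasurableSet {w : ℕ → M × N | w (n + 1) ∈ B} := measurable_pi_apply (n + 1) hBm
  have hqn : Measurable fun w : ℕ → M × N => Φ.noisyTransition (P.map (ξ 0)) (w n) B :=
    (Φ.measurable_noisyTransition _ hBm).comp (measurable_pi_apply n)
  rw [noisyPathLaw, Measure.map_apply hm (hCm.inter hBn), Measure.prod_apply (hm (hCm.inter hBn)),
    ← lintegral_indicator hCm, lintegral_map' (hqn.indicator hCm).aemeasurable hm.aemeasurable]
  refine Eq.trans ?_ (lintegral_prod _ ((hqn.indicator hCm).comp hm).aemeasurable).symm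
  refine lintegral_congr fun x => ?_
  have h := isMarkovLaw_noisyPath_apply hΦ hξ x n C hC B hB
  rw [Measure.map_apply (hpm x) (hCm.inter hBn), ← lintegral_indicator hCm,
    lintegral_map (hqn.indicator hCm) (hpm x)] at h
  exact h

variable [IsProbabilityMeasure μ]

/-- At any time the state and the noise variable are independent, of laws `μ` and `P.map (ξ 0)`. -/
theorem map_noisyPathLaw (hμ : Φ.IsInvariantMeasure μ) (hξ : Φ.IsIIDNoise ξ) (n : ℕ) :
    (Φ.noisyPathLaw ξ μ).map (fun w => w n) = μ.prod (P.map (ξ 0)) := by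
  have hη : IsProbabilityMeasure (P.map (ξ 0)) :=
    Measure.isProbabilityMeasure_map (hξ.measurable 0).aemeasurable
  have hm := Φ.measurable_noisyPath hξ.measurable
  refine (Measure.prod_eq fun A U hA hU => ?_).symm
  have hAU : MeasurableSet (A ×ˢ U) := MeasurableSet.prod hA hU
  have hAn : MeasurableSet {w : ℕ → M × N | w n ∈ A ×ˢ U} := measurable_pi_apply n hAU
  rw [Measure.map_apply (measurable_pi_apply n) hAU]
  change Φ.noisyPathLaw ξ μ {w : ℕ → M × N | w n ∈ A ×ˢ U} = _
  rw [noisyPathLaw, Measure.map_apply hm hAn, Measure.prod_apply (hm hAn)]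
  have h1 : ∀ x, P (Prod.mk x ⁻¹' (Φ.noisyPath ξ ⁻¹' {w : ℕ → M × N | w n ∈ A ×ˢ U})) =
      P {ω | Φ.T (n : 𝕋) ω x ∈ A} * P.map (ξ 0) U := by
    intro x
    have := hξ.measure_inter (Φ.measurable_T_dynamicsAlgebra n x hA) (T := ∅) (V := Set.univ)
      MeasurableSet.univ (Set.notMem_empty n) hU
    rw [Set.inter_univ, measure_univ, mul_one] at this
    exact this
  simp only [h1]
  rw [lintegral_mul_const _ (Φ.measurable_transition (n : 𝕋) hA)]
  congr 1
  rw [← (hμ.measurePreserving n).measure_preimage hA.nullMeasurableSet,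
    Measure.prod_apply (Φ.measurable_T_swap _ hA)]
  rfl

/-- The process of states and noise variables is ergodic. -/
theorem ergodic_noisyPathLaw (hΦ : Φ.IsMarkovFamily) (hμ : Φ.IsInvariantMeasure μ)
    (herg : Φ.IsErgodic μ) (hξ : Φ.IsIIDNoise ξ) :
    Ergodic (pathShift 1) (Φ.noisyPathLaw ξ μ) := by
  have hη : IsProbabilityMeasure (P.map (ξ 0)) :=
    Measure.isProbabilityMeasure_map (hξ.measurable 0).aemeasurable
  have hpm := Φ.measurable_noisyPath hξ.measurable
  have hν : IsProbabilityMeasure (Φ.noisyPathLaw ξ μ) :=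
    Measure.isProbabilityMeasure_map hpm.aemeasurable
  have hmark := isMarkovLaw_noisyPathLaw (μ := μ) hΦ hξ
  have hmap := map_noisyPathLaw hμ hξ
  have hm : ∀ i, Measurable fun w : ℕ → M × N => w i := fun i => measurable_pi_apply i
  have hm1 : ∀ i, Measurable fun w : ℕ → M × N => (w i).1 := fun i => measurable_fst.comp (hm i)
  have hSm : ∀ B ∈ rectangles M N, MeasurableSet B := by
    rintro _ ⟨A, hA, U, hU, rfl⟩
    exact MeasurableSet.prod hA hU
  refine hmark.ergodic_pathShift generateFrom_prod.symm isPiSystem_prod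
    ⟨Set.univ, MeasurableSet.univ, Set.univ, MeasurableSet.univ, Set.univ_prod_univ⟩
    (fun B hB => Φ.measurable_noisyTransition _ (hSm B hB)) ((hmap 1).trans (hmap 0).symm) ?_
  intro A hA hinv
  set η := P.map (ξ 0)
  have hν' : (Φ.noisyPathLaw ξ μ) = (μ.prod P).map (Φ.noisyPath ξ) := rfl
  set ν := Φ.noisyPathLaw ξ μ
  have hAπ : ν {w | w 0 ∈ A} = (μ.prod η) A := by
    rw [← hmap 0, Measure.map_apply (hm 0) hA]; rfl
  set a : M → ℝ≥0∞ := fun y => η (Prod.mk y ⁻¹' A) with ha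
  have ham : Measurable a := measurable_measure_prodMk_left hA
  have hAa : (μ.prod η) A = ∫⁻ y, a y ∂μ := Measure.prod_apply hA
  -- Even on the event `w 0 ∈ A`, the noise at time `1` is independent of the state at time `1`, as
  -- the transition probability factors.
  set ρ := (ν.restrict {w | w 0 ∈ A}).map fun w => (w 1).1
  have hρ : (ν.restrict {w | w 0 ∈ A}).map (fun w => w 1) = ρ.prod η := by
    refine (Measure.prod_eq fun B U hB hU => ?_).symm
    have hp : Measurable fun w : ℕ → M × N => P {ω | Φ.T ((1 : ℕ) : 𝕋) ω (w 0).1 ∈ B} :=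
      (Φ.measurable_transition ((1 : ℕ) : 𝕋) hB).comp (hm1 0)
    have hstep : ∀ U : Set N, MeasurableSet U →
        ν.restrict {w | w 0 ∈ A} ((fun w => w 1) ⁻¹' (B ×ˢ U)) =
        (∫⁻ w in {w : ℕ → M × N | w 0 ∈ A}, P {ω | Φ.T ((1 : ℕ) : 𝕋) ω (w 0).1 ∈ B} ∂ν) * η U := by
      intro U hU
      have h := hmark 0 {w | w 0 ∈ A} (measurable_coord le_rfl hA) _ ⟨B, hB, U, hU, rfl⟩
      simp only [noisyTransition_prod] at h
      rw [lintegral_mul_const _ hp] at h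
      rw [Measure.restrict_apply (hm 1 (MeasurableSet.prod hB hU)), Set.inter_comm]
      exact h
    have h1 := hstep Set.univ MeasurableSet.univ
    rw [measure_univ, mul_one] at h1
    rw [Measure.map_apply (hm 1) (MeasurableSet.prod hB hU), hstep U hU, ← h1,
      Measure.map_apply (hm1 1) hB]
    congr 2
    ext w
    simp
  -- Here `w 0 ∈ A` and `w 1 ∈ A` are almost surely the same event. Averaging over the fresh noise
  -- turns the indicator of `w 1 ∈ A` into `a (w 1).1`; replacing `w 0 ∈ A` by `w 1 ∈ A` and
  -- averaging once more yields a second factor `a`. Since `0 ≤ a ≤ 1`, equality of the integrals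
  -- forces `a` to be `0` or `1` almost everywhere.
  have hsq : ∫⁻ y, a y ∂μ = ∫⁻ y, a y * a y ∂μ := by
    have haf : Measurable fun z : M × N => a z.1 := ham.comp measurable_fst
    calc ∫⁻ y, a y ∂μ = ν {w | w 0 ∈ A} := by rw [hAπ, hAa]
      _ = ν ({w | w 1 ∈ A} ∩ {w | w 0 ∈ A}) := by
          refine measure_congr ?_
          have := (hinv 1).inter (ae_eq_refl {w : ℕ → M × N | w 0 ∈ A})
          rw [Set.inter_self] at this
          exact this.symm
      _ = (ν.restrict {w | w 0 ∈ A}).map (fun w => w 1) A := by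
          rw [Measure.map_apply (hm 1) hA, Measure.restrict_apply (hm 1 hA)]; rfl
      _ = ∫⁻ w in {w : ℕ → M × N | w 0 ∈ A}, a (w 1).1 ∂ν := by
          rw [hρ, Measure.prod_apply hA, lintegral_map ham (hm1 1)]
      _ = ∫⁻ w in {w : ℕ → M × N | w 1 ∈ A}, a (w 1).1 ∂ν := by
          rw [Measure.restrict_congr_set (hinv 1)]
      _ = ∫⁻ z in A, a z.1 ∂(μ.prod η) := by
          rw [← hmap 1, Measure.restrict_map (hm 1) hA,
            lintegral_map haf (hm 1)]
          rfl
      _ = ∫⁻ y, a y * a y ∂μ := by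
          rw [← lintegral_indicator hA, lintegral_prod _ (haf.indicator hA).aemeasurable]
          refine lintegral_congr fun y => ?_
          have : ∀ z, A.indicator (fun z : M × N => a z.1) (y, z) =
              (Prod.mk y ⁻¹' A).indicator (fun _ => a y) z := fun z => rfl
          simp only [this]
          rw [lintegral_indicator_const (measurable_prodMk_left hA)]
  have ha1 : ∀ y, a y ≤ 1 := fun y => prob_le_one
  have h01 : ∀ᵐ y ∂μ, a y * a y = a y := by
    refine ae_eq_of_ae_le_of_lintegral_le (ae_of_all _ fun y => mul_le_of_le_one_right' (ha1 y))
      ?_ ham.aemeasurable hsq.le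
    rw [← hsq, ← hAa]; exact measure_ne_top _ _
  set A' : Set M := {y | a y = 1}
  have hA' : MeasurableSet A' := ham (measurableSet_singleton 1)
  -- Almost every fibre of `A` is null or full, so membership in `A` depends on the state alone.
  have hAA' : ∀ᵐ z ∂(μ.prod η), z ∈ A ↔ z.1 ∈ A' := by
    have hms : MeasurableSet {z : M × N | z ∈ A ↔ z.1 ∈ A'} :=
      hA.iff (measurable_fst hA')
    rw [Measure.ae_prod_iff_ae_ae hms]
    filter_upwards [h01] with y hy
    by_cases hy1 : a y = 1
    · have : ∀ᵐ z ∂η, z ∈ Prod.mk y ⁻¹' A :=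
        (mem_ae_iff_prob_eq_one (measurable_prodMk_left hA)).2 hy1
      filter_upwards [this] with z hz
      exact iff_of_true hz hy1
    · have hy0 : a y = 0 := by
        by_contra hne
        exact hy1 ((ENNReal.mul_eq_left hne ((ha1 y).trans_lt ENNReal.one_lt_top).ne).1 hy)
      have : ∀ᵐ z ∂η, z ∉ Prod.mk y ⁻¹' A := measure_eq_zero_iff_ae_notMem.1 hy0
      filter_upwards [this] with z hz
      exact iff_of_false hz hy1
  have hnA' : ∀ n, {w : ℕ → M × N | (w n).1 ∈ A'} =ᵐ[ν] {w | w 0 ∈ A} := by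
    intro n
    refine EventuallyEq.trans ?_ (hinv n)
    have : ∀ᵐ w ∂ν, w n ∈ A ↔ (w n).1 ∈ A' := by
      rw [← hmap n] at hAA'
      exact ae_of_ae_map (hm n).aemeasurable hAA'
    filter_upwards [this] with w hw
    exact propext hw.symm
  have hμA' : μ A' = ν {w | w 0 ∈ A} := by
    rw [← measure_congr (hnA' 0)]
    have : ν {w | (w 0).1 ∈ A'} = (μ.prod η) (A' ×ˢ Set.univ) := by
      rw [← hmap 0, Measure.map_apply (hm 0) (MeasurableSet.prod hA' MeasurableSet.univ)]
      congr 1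
      ext w; simp
    rw [this, Measure.prod_prod, measure_univ, mul_one]
  rw [← hμA']
  refine herg A' ⟨hA', fun n => ?_⟩
  have h1 : ν ({w | (w n).1 ∈ A'} ∩ {w | (w 0).1 ∈ A'}) = μ A' := by
    rw [hμA']
    refine measure_congr ?_
    have := (hnA' n).inter (hnA' 0)
    rwa [Set.inter_self] at this
  have hms : MeasurableSet ({w : ℕ → M × N | (w n).1 ∈ A'} ∩ {w | (w 0).1 ∈ A'}) :=
    (hm1 n hA').inter (hm1 0 hA')
  rw [hν', Measure.map_apply hpm hms, Measure.prod_apply (hpm hms)] at h1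
  rw [← h1, ← lintegral_indicator hA']
  refine lintegral_congr fun x => ?_
  by_cases hx : x ∈ A'
  · simp [hx, noisyPath, Φ.T_zero]
  · simp [hx, noisyPath, Φ.T_zero]

end RandomDynSys

namespace RandomDynSys

variable {𝕋 : Type*} [AddMonoidWithOne 𝕋] {Ω : Type*} {mΩ : MeasurableSpace Ω} {P : Measure Ω}
  [IsProbabilityMeasure P] {M : Type*} [mM : MeasurableSpace M] {N : Type*}
  [mN : MeasurableSpace N] {Φ : RandomDynSys 𝕋 P M} {ξ : ℕ → Ω → N} {μ : Measure M}
  [IsProbabilityMeasure μ]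

/-! ### Correlations of noisy observables -/

theorem IsIIDNoise.map_pair (hξ : Φ.IsIIDNoise ξ) {s : ℕ} (hs : s ≠ 0) :
    P.map (fun ω => (ξ 0 ω, ξ s ω)) = (P.map (ξ 0)).prod (P.map (ξ 0)) := by
  have hη : IsProbabilityMeasure (P.map (ξ 0)) :=
    Measure.isProbabilityMeasure_map (hξ.measurable 0).aemeasurable
  refine (Measure.prod_eq fun U V hU hV => ?_).symm
  have hU' : MeasurableSet[⨆ i ∈ ({0} : Set ℕ), mN.comap (ξ i)] (ξ 0 ⁻¹' U) :=
    le_iSup₂ (f := fun i (_ : i ∈ ({0} : Set ℕ)) => mN.comap (ξ i)) 0 rfl _ ⟨U, hU, rfl⟩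
  have h := hξ.measure_inter MeasurableSet.univ hU' (Set.mem_singleton_iff.not.2 hs) hV
  rw [Set.univ_inter, measure_univ, one_mul, hξ.measure_preimage 0 hU] at h
  rw [Measure.map_apply ((hξ.measurable 0).prodMk (hξ.measurable s)) (MeasurableSet.prod hU hV),
    ← h]
  rfl

/-- At two different times, the pair of the noise variables is independent of the pair of the
states, and consists of independent variables. -/
theorem map_pair_noisyPathLaw (hξ : Φ.IsIIDNoise ξ) {s : ℕ} (hs : s ≠ 0) :
    (Φ.noisyPathLaw ξ μ).map (fun w => (((w 0).1, (w s).1), ((w 0).2, (w s).2))) =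
      ((μ.prod P).map fun p => (p.1, Φ.T (s : 𝕋) p.2 p.1)).prod
        ((P.map (ξ 0)).prod (P.map (ξ 0))) := by
  have hη : IsProbabilityMeasure (P.map (ξ 0)) :=
    Measure.isProbabilityMeasure_map (hξ.measurable 0).aemeasurable
  have hm : ∀ i, Measurable fun w : ℕ → M × N => w i := fun i => measurable_pi_apply i
  have hpm := Φ.measurable_noisyPath hξ.measurable
  have hq : Measurable fun w : ℕ → M × N => (((w 0).1, (w s).1), ((w 0).2, (w s).2)) := by
    fun_prop
  have hpair : Measurable fun p : M × Ω => (p.1, Φ.T (s : 𝕋) p.2 p.1) :=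
    measurable_fst.prodMk (Φ.measurable_T_swap _)
  have hξp : Measurable fun ω => (ξ 0 ω, ξ s ω) := (hξ.measurable 0).prodMk (hξ.measurable s)
  have : IsProbabilityMeasure ((μ.prod P).map fun p => (p.1, Φ.T (s : 𝕋) p.2 p.1)) :=
    Measure.isProbabilityMeasure_map hpair.aemeasurable
  refine (Measure.prod_eq fun B V hB hV => ?_).symm
  have hBV : MeasurableSet (B ×ˢ V) := MeasurableSet.prod hB hV
  rw [noisyPathLaw, Measure.map_map hq hpm, Measure.map_apply (hq.comp hpm) hBV,
    Measure.prod_apply ((hq.comp hpm) hBV), Measure.map_apply hpair hB,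
    Measure.prod_apply (hpair hB), ← hξ.map_pair hs, Measure.map_apply hξp hV,
    ← lintegral_mul_const _ (measurable_measure_prodMk_left (hpair hB))]
  refine lintegral_congr fun x => ?_
  have hD : MeasurableSet[Φ.dynamicsAlgebra] {ω | (x, Φ.T (s : 𝕋) ω x) ∈ B} :=
    Φ.measurable_T_dynamicsAlgebra s x (measurable_prodMk_left hB)
  have hE : MeasurableSet[⨆ t, mN.comap (ξ t)] ((fun ω => (ξ 0 ω, ξ s ω)) ⁻¹' V) := by
    have h1 : ∀ t, Measurable[⨆ t, mN.comap (ξ t)] (ξ t) := fun t =>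
      Measurable.of_comap_le (le_iSup (fun t => mN.comap (ξ t)) t)
    exact ((h1 0).prodMk (h1 s)) hV
  have h2 := (Indep_iff _ _ _).1 hξ.indep _ _ hE hD
  rw [mul_comm] at h2
  refine Eq.trans ?_ h2
  congr 1
  ext ω
  simp only [noisyPath, Nat.cast_zero, Φ.T_zero, Set.mem_preimage, Function.comp, Set.mem_prod,
    Set.mem_inter_iff, id]
  exact and_comm

/-- The correlations of two noisy observables at different times. -/
theorem integrable_and_integral_correlation (hμ : Φ.IsInvariantMeasure μ) (hξ : Φ.IsIIDNoise ξ)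
    {f g : N → M → ℂ} (hf : Measurable fun p : N × M => f p.1 p.2)
    (hg : Measurable fun p : N × M => g p.1 p.2)
    (hf2 : ∫⁻ x, (∫⁻ ω, ‖f (ξ 0 ω) x‖ₑ ∂P) ^ 2 ∂μ < ∞)
    (hg2 : ∫⁻ x, (∫⁻ ω, ‖g (ξ 0 ω) x‖ₑ ∂P) ^ 2 ∂μ < ∞) {s : ℕ} (hs : s ≠ 0) :
    Integrable (fun w : ℕ → M × N => f (w s).2 (w s).1 * star (g (w 0).2 (w 0).1))
      (Φ.noisyPathLaw ξ μ) ∧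
    ∫ w, f (w s).2 (w s).1 * star (g (w 0).2 (w 0).1) ∂(Φ.noisyPathLaw ξ μ) =
      ∫ x, Φ.koopman (s : 𝕋) (fun y => ∫ ω, f (ξ 0 ω) y ∂P) x * star (∫ ω, g (ξ 0 ω) x ∂P) ∂μ := by
  have hη : IsProbabilityMeasure (P.map (ξ 0)) :=
    Measure.isProbabilityMeasure_map (hξ.measurable 0).aemeasurable
  have hm : ∀ i, Measurable fun w : ℕ → M × N => w i := fun i => measurable_pi_apply i
  have hq : Measurable fun w : ℕ → M × N => (((w 0).1, (w s).1), ((w 0).2, (w s).2)) := by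
    fun_prop
  have hpair : Measurable fun p : M × Ω => (p.1, Φ.T (s : 𝕋) p.2 p.1) :=
    measurable_fst.prodMk (Φ.measurable_T_swap _)
  have hlaw := map_pair_noisyPathLaw (μ := μ) hξ hs
  have hfx : ∀ x, Measurable fun z => f z x := fun x => hf.comp measurable_prodMk_right
  have hgx : ∀ x, Measurable fun z => g z x := fun x => hg.comp measurable_prodMk_right
  have hτ : IsProbabilityMeasure ((μ.prod P).map fun p => (p.1, Φ.T (s : 𝕋) p.2 p.1)) :=
    Measure.isProbabilityMeasure_map hpair.aemeasurable
  have hfη : ∀ x, ∫ ω, f (ξ 0 ω) x ∂P = ∫ z, f z x ∂(P.map (ξ 0)) := fun x =>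
    (integral_map (hξ.measurable 0).aemeasurable (hfx x).aestronglyMeasurable).symm
  have hgη : ∀ x, ∫ ω, g (ξ 0 ω) x ∂P = ∫ z, g z x ∂(P.map (ξ 0)) := fun x =>
    (integral_map (hξ.measurable 0).aemeasurable (hgx x).aestronglyMeasurable).symm
  have hfa : ∀ x, ∫⁻ ω, ‖f (ξ 0 ω) x‖ₑ ∂P = ∫⁻ z, ‖f z x‖ₑ ∂(P.map (ξ 0)) := fun x =>
    (lintegral_map (hfx x).enorm (hξ.measurable 0)).symm
  have hga : ∀ x, ∫⁻ ω, ‖g (ξ 0 ω) x‖ₑ ∂P = ∫⁻ z, ‖g z x‖ₑ ∂(P.map (ξ 0)) := fun x =>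
    (lintegral_map (hgx x).enorm (hξ.measurable 0)).symm
  simp only [hfa, hga] at hf2 hg2
  simp only [hfη, hgη]
  set η := P.map (ξ 0)
  set τ := (μ.prod P).map fun p => (p.1, Φ.T (s : 𝕋) p.2 p.1) with hτdef
  have ham : Measurable fun x => ∫⁻ z, ‖f z x‖ₑ ∂η :=
    Measurable.lintegral_prod_left' (f := fun p : N × M => ‖f p.1 p.2‖ₑ) hf.enorm
  have hbm : Measurable fun x => ∫⁻ z, ‖g z x‖ₑ ∂η :=
    Measurable.lintegral_prod_left' (f := fun p : N × M => ‖g p.1 p.2‖ₑ) hg.enorm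
  let G : (M × M) × (N × N) → ℂ := fun p => f p.2.2 p.1.2 * star (g p.2.1 p.1.1)
  have hGm : Measurable G := by
    have h1 : Measurable fun p : (M × M) × (N × N) => f p.2.2 p.1.2 :=
      hf.comp ((measurable_snd.comp measurable_snd).prodMk (measurable_snd.comp measurable_fst))
    have h2 : Measurable fun p : (M × M) × (N × N) => g p.2.1 p.1.1 :=
      hg.comp ((measurable_fst.comp measurable_snd).prodMk (measurable_fst.comp measurable_fst))
    exact h1.mul (Complex.continuous_conj.measurable.comp h2)
  -- Independence of the two noises factors the absolute moment into absolute means, so no second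
  -- moment of the noise enters. The bound `ab ≤ a² + b²` and invariance of `μ` then reduce to the
  -- hypotheses.
  have hGint : Integrable G (τ.prod (η.prod η)) := by
    refine ⟨hGm.aestronglyMeasurable, ?_⟩
    rw [hasFiniteIntegral_iff_enorm, lintegral_prod _ hGm.enorm.aemeasurable]
    have h1 : ∀ p : M × M, ∫⁻ z : N × N, ‖G (p, z)‖ₑ ∂(η.prod η) =
        (∫⁻ z, ‖g z p.1‖ₑ ∂η) * ∫⁻ z, ‖f z p.2‖ₑ ∂η := by
      intro p
      rw [← lintegral_prod_mul (hgx p.1).enorm.aemeasurable (hfx p.2).enorm.aemeasurable]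
      refine lintegral_congr fun z => ?_
      simp only [G, enorm_mul]
      rw [mul_comm]
      congr 1
      simp [enorm_eq_nnnorm]
    simp only [h1]
    calc ∫⁻ p : M × M, (∫⁻ z, ‖g z p.1‖ₑ ∂η) * ∫⁻ z, ‖f z p.2‖ₑ ∂η ∂τ
        ≤ ∫⁻ p : M × M, ((∫⁻ z, ‖g z p.1‖ₑ ∂η) ^ 2 + (∫⁻ z, ‖f z p.2‖ₑ ∂η) ^ 2) ∂τ := by
          refine lintegral_mono fun p => ?_
          generalize (∫⁻ z, ‖g z p.1‖ₑ ∂η) = a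
          generalize (∫⁻ z, ‖f z p.2‖ₑ ∂η) = b
          rcases le_total a b with h | h
          · exact (mul_le_mul' h le_rfl).trans ((sq b).symm.le.trans le_add_self)
          · exact (mul_le_mul' le_rfl h).trans ((sq a).symm.le.trans le_self_add)
      _ = ∫⁻ x, (∫⁻ z, ‖g z x‖ₑ ∂η) ^ 2 ∂μ + ∫⁻ x, (∫⁻ z, ‖f z x‖ₑ ∂η) ^ 2 ∂μ := by
          have hb1 : Measurable fun p : M × M => (∫⁻ z, ‖g z p.1‖ₑ ∂η) ^ 2 :=
            (hbm.comp measurable_fst).pow_const 2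
          have ha2 : Measurable fun p : M × M => (∫⁻ z, ‖f z p.2‖ₑ ∂η) ^ 2 :=
            (ham.comp measurable_snd).pow_const 2
          rw [lintegral_add_left hb1, lintegral_map hb1 hpair, lintegral_map ha2 hpair]
          congr 1
          · exact measurePreserving_fst.lintegral_comp (hbm.pow_const 2)
          · exact (hμ.measurePreserving s).lintegral_comp (ham.pow_const 2)
      _ < ∞ := ENNReal.add_lt_top.2 ⟨hg2, hf2⟩
  rw [← hlaw] at hGint
  refine ⟨hGint.comp_measurable hq, ?_⟩
  have h2 : ∫ w, f (w s).2 (w s).1 * star (g (w 0).2 (w 0).1) ∂(Φ.noisyPathLaw ξ μ) =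
      ∫ p, G p ∂(τ.prod (η.prod η)) := by
    rw [← hlaw, integral_map hq.aemeasurable hGm.aestronglyMeasurable]
  rw [hlaw] at hGint
  have h3 : ∀ p : M × M, ∫ z, G (p, z) ∂(η.prod η) =
      (∫ z, f z p.2 ∂η) * star (∫ z, g z p.1 ∂η) := by
    intro p
    have h4 := integral_prod_mul (μ := η) (ν := η) (fun z => star (g z p.1)) (fun z => f z p.2)
    have h5 : ∫ z, star (g z p.1) ∂η = star (∫ z, g z p.1 ∂η) := integral_conj
    rw [h5, mul_comm] at h4
    rw [← h4]
    exact integral_congr_ae (ae_of_all _ fun z => mul_comm _ _)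
  have hint := hGint.integral_prod_left
  simp only [h3] at hint
  rw [h2, integral_prod _ hGint]
  simp only [h3]
  rw [hτdef, integral_map hpair.aemeasurable hint.1]
  have hint' := hint.comp_measurable hpair
  refine (integral_prod _ hint').trans ?_
  refine integral_congr_ae (ae_of_all _ fun x => ?_)
  exact integral_mul_const (star (∫ z, g z x ∂η))
    (fun ω => ∫ z, f z (Φ.T (s : 𝕋) ω x) ∂η)

/-- The Chapman-Kolmogorov equation for the stochastic Koopman operators. -/
theorem koopman_two (hΦ : Φ.IsMarkovFamily) (hμ : Φ.IsInvariantMeasure μ) {f : M → ℂ}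
    (hfm : Measurable f) (hf : Integrable f μ) :
    Φ.koopman ((2 : ℕ) : 𝕋) f =ᵐ[μ] Φ.koopman 1 (Φ.koopman 1 f) := by
  have h1 := ((hμ.measurePreserving 2).integrable_comp_of_integrable hf).prod_right_ae
  filter_upwards [h1] with x hx
  have hT := Φ.measurable_T_swap ((1 : ℕ) : 𝕋)
  have hX1 := Φ.measurable_T_apply ((1 : ℕ) : 𝕋) x
  have hX2 := Φ.measurable_T_apply ((2 : ℕ) : 𝕋) x
  -- By the Markov property, `x_2` has the law of `x_1` moved by an independent copy of the one-step
  -- map.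
  have hlaw : P.map (fun ω => Φ.T ((2 : ℕ) : 𝕋) ω x) =
      ((P.map fun ω => Φ.T ((1 : ℕ) : 𝕋) ω x).prod P).map
        fun p : M × Ω => Φ.T ((1 : ℕ) : 𝕋) p.2 p.1 := by
    ext A hA
    rw [Measure.map_apply hX2 hA, Measure.map_apply hT hA, Measure.prod_apply (hT hA),
      lintegral_map (measurable_measure_prodMk_left (hT hA)) hX1]
    have := hΦ.measure_inter x 1 1 hA MeasurableSet.univ
    rw [Set.univ_inter, Measure.restrict_univ] at this
    exact this
  have hi : Integrable f (P.map fun ω => Φ.T ((2 : ℕ) : 𝕋) ω x) :=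
    (integrable_map_measure hfm.aestronglyMeasurable hX2.aemeasurable).2 hx
  have h2 : Φ.koopman ((2 : ℕ) : 𝕋) f x = ∫ y, f y ∂(P.map fun ω => Φ.T ((2 : ℕ) : 𝕋) ω x) :=
    (integral_map hX2.aemeasurable hfm.aestronglyMeasurable).symm
  rw [h2, hlaw, integral_map hT.aemeasurable hfm.aestronglyMeasurable]
  rw [hlaw] at hi
  have hi' := hi.comp_measurable hT
  refine (integral_prod _ hi').trans ?_
  rw [integral_map hX1.aemeasurable hi'.integral_prod_left.1]
  simp only [koopman, Nat.cast_one]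
  rfl

/-- The time averages of the correlations of two noisy observables. -/
theorem ae_tendsto_correlation (hΦ : Φ.IsMarkovFamily) (hμ : Φ.IsInvariantMeasure μ)
    (herg : Φ.IsErgodic μ) (hξ : Φ.IsIIDNoise ξ)
    {f g : N → M → ℂ} (hf : Measurable fun p : N × M => f p.1 p.2)
    (hg : Measurable fun p : N × M => g p.1 p.2)
    (hf2 : ∫⁻ x, (∫⁻ ω, ‖f (ξ 0 ω) x‖ₑ ∂P) ^ 2 ∂μ < ∞)
    (hg2 : ∫⁻ x, (∫⁻ ω, ‖g (ξ 0 ω) x‖ₑ ∂P) ^ 2 ∂μ < ∞) {s : ℕ} (hs : s ≠ 0) :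
    ∀ᵐ p ∂(μ.prod P), Tendsto (fun n : ℕ => 1 / (n : ℂ) * ∑ m ∈ Finset.range n,
        f (ξ (m + s) p.2) (Φ.T ((m + s : ℕ) : 𝕋) p.2 p.1) *
          star (g (ξ m p.2) (Φ.T ((m : ℕ) : 𝕋) p.2 p.1))) atTop
      (𝓝 (∫ x, Φ.koopman (s : 𝕋) (fun y => ∫ ω, f (ξ 0 ω) y ∂P) x *
        star (∫ ω, g (ξ 0 ω) x ∂P) ∂μ)) := by
  have hpm := Φ.measurable_noisyPath hξ.measurable
  have hν : IsProbabilityMeasure (Φ.noisyPathLaw ξ μ) :=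
    Measure.isProbabilityMeasure_map hpm.aemeasurable
  have hm : ∀ i, Measurable fun w : ℕ → M × N => w i := fun i => measurable_pi_apply i
  obtain ⟨hint, hval⟩ := integrable_and_integral_correlation hμ hξ hf hg hf2 hg2 hs
  have hφm : Measurable fun w : ℕ → M × N => f (w s).2 (w s).1 * star (g (w 0).2 (w 0).1) :=
    (hf.comp ((hm s).snd.prodMk (hm s).fst)).mul
      (Complex.continuous_conj.measurable.comp (hg.comp ((hm 0).snd.prodMk (hm 0).fst)))
  have h := (ergodic_noisyPathLaw hΦ hμ herg hξ).ae_tendsto_birkhoffSum_complex hφm hint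
  rw [hval] at h
  filter_upwards [ae_of_ae_map hpm.aemeasurable h] with p hp
  refine hp.congr fun n => ?_
  simp only [birkhoffSum, iterate_pathShift_one]
  rfl

end RandomDynSys

/-! ### Correlations for observables carried by a noise σ-algebra -/

namespace RandomDynSys

variable {𝕋 : Type*} [AddMonoidWithOne 𝕋] {Ω : Type*} {mΩ : MeasurableSpace Ω} {P : Measure Ω}
  [IsProbabilityMeasure P] {M : Type*} [mM : MeasurableSpace M] {Φ : RandomDynSys 𝕋 P M}
  {μ : Measure M} [IsProbabilityMeasure μ] {k : ℕ} {F : Ω → M → Fin k → ℂ}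

omit [IsProbabilityMeasure P] in
theorem HasIIDMeasurementNoise.measurable (hF : Φ.HasIIDMeasurementNoise F) (i : Fin k) :
    Measurable fun p : Ω × M => F p.1 p.2 i := by
  obtain ⟨𝒩, h𝒩, hFm, -, -⟩ := hF
  have h : Measurable[mΩ.prod mM] fun p : Ω × M => F p.1 p.2 :=
    hFm.mono (sup_le_sup (MeasurableSpace.comap_mono h𝒩) le_rfl) le_rfl
  exact (measurable_pi_apply i).comp h

theorem HasIIDMeasurementNoise.measurable_obsMean (hF : Φ.HasIIDMeasurementNoise F) (i : Fin k) :
    Measurable (obsMean P F i) :=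
  (StronglyMeasurable.integral_prod_left' (f := fun p : Ω × M => F p.1 p.2 i)
    (hF.measurable i).stronglyMeasurable).measurable

/-- The time averages of the correlations of the components of a noisy observable `f (e ω)`, if the
noise variables `e (θ_t ω)` are independent, and independent of the dynamics. -/
theorem ae_tendsto_correlation_comp {N : Type*} [mN : MeasurableSpace N] {e : Ω → N}
    (he : Measurable e) (hi : iIndep (fun t : ℕ => mN.comap (e ∘ Φ.θ (t : 𝕋))) P)
    (hd : Indep (⨆ t : ℕ, mN.comap (e ∘ Φ.θ (t : 𝕋))) Φ.dynamicsAlgebra P)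
    {f : N → M → Fin k → ℂ} (hfm : Measurable fun p : N × M => f p.1 p.2)
    (hΦ : Φ.IsMarkovFamily) (hμ : Φ.IsInvariantMeasure μ) (herg : Φ.IsErgodic μ)
    (habs : ∀ i, ∫⁻ x, (∫⁻ ω, ‖f (e ω) x i‖ₑ ∂P) ^ 2 ∂μ < ∞) (i j : Fin k) {s : ℕ} (hs : s ≠ 0) :
    ∀ᵐ p ∂(μ.prod P), Tendsto (fun n : ℕ => 1 / (n : ℂ) * ∑ m ∈ Finset.range n,
        Φ.sample (fun ω => f (e ω)) p.1 p.2 ((m + s : ℕ) : 𝕋) i *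
          star (Φ.sample (fun ω => f (e ω)) p.1 p.2 (m : 𝕋) j)) atTop
      (𝓝 (∫ x, Φ.koopman (s : 𝕋) (obsMean P (fun ω => f (e ω)) i) x *
        star (obsMean P (fun ω => f (e ω)) j x) ∂μ)) := by
  have h0 : ∀ ω, Φ.θ ((0 : ℕ) : 𝕋) ω = ω := fun ω => by rw [Nat.cast_zero, Φ.θ_zero]; rfl
  have hξ : Φ.IsIIDNoise (fun t : ℕ => e ∘ Φ.θ (t : 𝕋)) := by
    refine ⟨fun t => he.comp (Φ.measurePreserving_θ t).measurable, fun t => ?_, hi, hd⟩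
    rw [← Measure.map_map he (Φ.measurePreserving_θ t).measurable,
      ← Measure.map_map he (Φ.measurePreserving_θ _).measurable,
      (Φ.measurePreserving_θ _).map_eq, (Φ.measurePreserving_θ _).map_eq]
  have hm : ∀ i, Measurable fun p : N × M => f p.1 p.2 i := measurable_pi_iff.1 hfm
  have h := ae_tendsto_correlation hΦ hμ herg hξ
    (f := fun z x => f z x i) (g := fun z x => f z x j) (hm i) (hm j)
    (by simpa only [Function.comp, h0] using habs i)
    (by simpa only [Function.comp, h0] using habs j) hs
  simp only [Function.comp, h0] at h
  exact h

/-- The time averages of the correlations of the components of a noisy observable with i.i.d.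
measurement noise. -/
theorem HasIIDMeasurementNoise.ae_tendsto_correlation (hF : Φ.HasIIDMeasurementNoise F)
    (hΦ : Φ.IsMarkovFamily) (hμ : Φ.IsInvariantMeasure μ) (herg : Φ.IsErgodic μ)
    (habs : ∀ i, ∫⁻ x, (∫⁻ ω, ‖F ω x i‖ₑ ∂P) ^ 2 ∂μ < ∞) (i j : Fin k) {s : ℕ} (hs : s ≠ 0) :
    ∀ᵐ p ∂(μ.prod P), Tendsto (fun n : ℕ => 1 / (n : ℂ) * ∑ m ∈ Finset.range n,
        Φ.sample F p.1 p.2 ((m + s : ℕ) : 𝕋) i * star (Φ.sample F p.1 p.2 (m : 𝕋) j)) atTop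
      (𝓝 (∫ x, Φ.koopman (s : 𝕋) (obsMean P F i) x * star (obsMean P F j x) ∂μ)) := by
  obtain ⟨𝒩, h𝒩, hFm, hi, hd⟩ := hF
  -- The noise space is `Ω` with the σ-algebra `𝒩`, and the noise variable is the identity, so the
  -- noise at time `t` is `θ_t` itself.
  have he : Measurable[mΩ, 𝒩] (id : Ω → Ω) := measurable_id'' h𝒩
  exact @ae_tendsto_correlation_comp 𝕋 _ Ω mΩ P _ M mM Φ μ _ k Ω 𝒩 id he hi hd F hFm hΦ hμ herg
    habs i j s hs

end RandomDynSys

/-! ### Linear algebra of the limit -/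

theorem pinv_eq_inv {n : Type*} [Fintype n] [DecidableEq n] {A : Matrix n n ℂ}
    (hA : A.det ≠ 0) : pinv A = A⁻¹ := by
  have hu : IsUnit A.det := isUnit_iff_ne_zero.2 hA
  refine (isMoorePenrose_pinv A).unique ⟨?_, ?_, ?_, ?_⟩ <;>
    simp [Matrix.mul_nonsing_inv _ hu, Matrix.nonsing_inv_mul _ hu]

/-- The pseudoinverse is continuous at invertible matrices. -/
theorem tendsto_pinv {n : Type*} [Fintype n] [DecidableEq n] {A : Matrix n n ℂ}
    (hA : A.det ≠ 0) : Tendsto pinv (𝓝 A) (𝓝 A⁻¹) := by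
  have hd : Tendsto (fun B : Matrix n n ℂ => B.det) (𝓝 A) (𝓝 A.det) :=
    (continuous_id.matrix_det).tendsto A
  have h1 : Tendsto (fun B : Matrix n n ℂ => B.det⁻¹ • B.adjugate) (𝓝 A)
      (𝓝 (A.det⁻¹ • A.adjugate)) :=
    (hd.inv₀ hA).smul ((continuous_id.matrix_adjugate).tendsto A)
  rw [← Ring.inverse_eq_inv', ← Matrix.inv_def] at h1
  -- Invertibility is an open condition, and near `A` the pseudoinverse is the adjugate divided by
  -- the determinant.
  refine h1.congr' ?_
  filter_upwards [hd.eventually_ne hA] with B hB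
  rw [pinv_eq_inv hB, Matrix.inv_def, Ring.inverse_eq_inv']

/-- If the correlation matrices of the data converge to `K G` and `K² G`, with `K` and `G`
invertible, then noise resistant DMD converges to `K`. -/
theorem tendsto_noiseResistantDMD {k : ℕ} {u v : ℕ → Fin k → ℂ} {K G : Matrix (Fin k) (Fin k) ℂ}
    (hK : K.det ≠ 0) (hG : G.det ≠ 0)
    (h0 : ∀ i j, Tendsto (fun n : ℕ => 1 / (n : ℂ) * ∑ m ∈ Finset.range n, u m i * star (v m j))
      atTop (𝓝 ((K * G) i j)))
    (h1 : ∀ i j, Tendsto (fun n : ℕ => 1 / (n : ℂ) * ∑ m ∈ Finset.range n,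
      u (m + 1) i * star (v m j)) atTop (𝓝 ((K * (K * G)) i j))) :
    Tendsto (noiseResistantDMD u v) atTop (𝓝 K) := by
  have hKG : (K * G).det ≠ 0 := by rw [Matrix.det_mul]; exact mul_ne_zero hK hG
  have e : K * (K * G) * (K * G)⁻¹ = K := by
    rw [Matrix.mul_assoc, Matrix.mul_nonsing_inv _ (isUnit_iff_ne_zero.2 hKG), Matrix.mul_one]
  rw [← e]
  refine Filter.Tendsto.mul (M := Matrix (Fin k) (Fin k) ℂ) ?_ ((tendsto_pinv hKG).comp ?_)
  · refine tendsto_pi_nhds.2 fun i => tendsto_pi_nhds.2 fun j => (h1 i j).congr fun n => ?_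
    rw [← Fin.sum_univ_eq_sum_range (fun m => u (m + 1) i * star (v m j))]
    simp [Matrix.mul_apply]
  · refine tendsto_pi_nhds.2 fun i => tendsto_pi_nhds.2 fun j => (h0 i j).congr fun n => ?_
    rw [← Fin.sum_univ_eq_sum_range (fun m => u m i * star (v m j))]
    simp [Matrix.mul_apply]

/-- The matrix of a linear map on the span of linearly independent vectors is invertible if the
map has full rank there. -/
theorem det_ne_zero_of_finrank_range_restrict {V : Type*} [AddCommGroup V] [Module ℂ V] {k : ℕ}
    {b : Fin k → V} (hb : LinearIndependent ℂ b) {L : V →ₗ[ℂ] V} {W : Submodule ℂ V}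
    [FiniteDimensional ℂ W] (hbW : ∀ i, b i ∈ W) (hdim : Module.finrank ℂ W = k)
    (hinv : ∀ g ∈ W, L g ∈ W)
    (hrank : Module.finrank ℂ (LinearMap.range (L.restrict hinv)) = k)
    {K : Matrix (Fin k) (Fin k) ℂ} (hK : ∀ i, L (b i) = ∑ j, K i j • b j) : K.det ≠ 0 := by
  have hsurj : Function.Surjective (L.restrict hinv) :=
    LinearMap.range_eq_top.1 (Submodule.eq_top_of_finrank_eq (hrank.trans hdim.symm))
  have hinj : Function.Injective (L.restrict hinv) :=
    LinearMap.injective_iff_surjective.2 hsurj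
  intro hdet
  -- The images of the basis are the rows of `K`, so a vector in the left kernel gives an element of
  -- `W` killed by `L`.
  obtain ⟨v, hv, hvK⟩ := Matrix.exists_vecMul_eq_zero_iff.2 hdet
  have hsum : L (∑ i, v i • b i) = 0 := by
    simp only [map_sum, map_smul, hK, Finset.smul_sum, smul_smul]
    rw [Finset.sum_comm]
    simp only [← Finset.sum_smul]
    refine Finset.sum_eq_zero fun j _ => ?_
    have : ∑ i, v i * K i j = 0 := congrFun hvK j
    rw [this, zero_smul]
  have hmem : ∑ i, v i • b i ∈ W := Submodule.sum_mem _ fun i _ => W.smul_mem _ (hbW i)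
  have h0 : (⟨_, hmem⟩ : W) = 0 := hinj (by
    rw [map_zero]; exact Subtype.ext hsum)
  exact hv (funext (Fintype.linearIndependent_iff.1 hb v (congrArg Subtype.val h0)))

open scoped ComplexOrder in
theorem det_gram_ne_zero {V : Type*} [NormedAddCommGroup V] [InnerProductSpace ℂ V] {k : ℕ}
    {b : Fin k → V} (hb : LinearIndependent ℂ b) : (Matrix.gram ℂ b).det ≠ 0 :=
  (Matrix.posDef_gram_of_linearIndependent hb).det_pos.ne'

/-! ### Convergence of noise resistant DMD -/

theorem mainTheorem4 {𝕋 : Type*} [AddMonoidWithOne 𝕋]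
    {Ω : Type*} [MeasurableSpace Ω] (P : Measure Ω) [IsProbabilityMeasure P]
    {M : Type*} [MeasurableSpace M] (Φ : RandomDynSys 𝕋 P M)
    (μ : Measure M) [IsProbabilityMeasure μ]
    (hMarkov : Φ.IsMarkovFamily) (hμ : Φ.IsInvariantMeasure μ) (herg : Φ.IsErgodic μ)
    {k : ℕ} (F : Ω → M → Fin k → ℂ) (hF : Φ.HasIIDMeasurementNoise F)
    (habs : ∀ i, ∫⁻ x, (∫⁻ ω, ‖F ω x i‖ₑ ∂P) ^ 2 ∂μ < ∞)
    (hf : ∀ i, MemLp (obsMean P F i) 2 μ)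
    (𝓕 : Submodule ℂ (Lp ℂ 2 μ))
    (hspan : 𝓕 = Submodule.span ℂ (Set.range fun i => (hf i).toLp (obsMean P F i)))
    (hdim : Module.finrank ℂ 𝓕 = k)
    (hinv : ∀ g ∈ 𝓕, Φ.koopmanL2 hμ g ∈ 𝓕)
    (hrank : Module.finrank ℂ (LinearMap.range ((Φ.koopmanL2 hμ).restrict hinv)) = k) :
    ∃ K : Matrix (Fin k) (Fin k) ℂ,
      (∀ i, Φ.koopmanL2 hμ ((hf i).toLp (obsMean P F i)) =
        ∑ j, K i j • (hf j).toLp (obsMean P F j)) ∧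
      ∀ᵐ p ∂(μ.prod P), Tendsto
        (noiseResistantDMD
          (fun m => Φ.sample F p.1 p.2 ((m + 1 : ℕ) : 𝕋))
          (fun m => Φ.sample F p.1 p.2 ((m : ℕ) : 𝕋)))
        atTop (𝓝 K) := by
  set b : Fin k → Lp ℂ 2 μ := fun i => (hf i).toLp (obsMean P F i) with hb
  have hbF : ∀ i, b i ∈ 𝓕 := fun i => hspan ▸ Submodule.subset_span ⟨i, rfl⟩
  have hli : LinearIndependent ℂ b := by
    rw [linearIndependent_iff_card_eq_finrank_span, Fintype.card_fin, Set.finrank, ← hspan, hdim]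
  have hfin : FiniteDimensional ℂ 𝓕 := by
    rw [hspan]; exact FiniteDimensional.span_of_finite ℂ (Set.finite_range _)
  have hexK : ∀ i, ∃ c : Fin k → ℂ, ∑ j, c j • b j = Φ.koopmanL2 hμ (b i) := fun i =>
    (Submodule.mem_span_range_iff_exists_fun ℂ).1 (hspan ▸ hinv _ (hbF i))
  choose K hK using hexK
  have hKdet : (Matrix.of K).det ≠ 0 :=
    det_ne_zero_of_finrank_range_restrict hli hbF hdim hinv hrank fun i => (hK i).symm
  refine ⟨Matrix.of K, fun i => (hK i).symm, ?_⟩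
  set G : Matrix (Fin k) (Fin k) ℂ :=
    Matrix.of fun i j => ∫ x, obsMean P F i x * star (obsMean P F j x) ∂μ with hG
  have hGdet : G.det ≠ 0 := by
    -- Transposed because the inner product is conjugate linear in its first argument.
    have h1 : G = (Matrix.gram ℂ b)ᵀ := by
      ext i j
      simp only [hG, Matrix.of_apply, Matrix.transpose_apply, Matrix.gram_apply, L2.inner_def]
      refine integral_congr_ae ?_
      filter_upwards [(hf i).coeFn_toLp, (hf j).coeFn_toLp] with x h1 h2
      simp [hb, h1, h2, RCLike.inner_apply]
    rw [h1, Matrix.det_transpose]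
    exact det_gram_ne_zero hli
  have hprod : ∀ i j, Integrable (fun x => obsMean P F i x * star (obsMean P F j x)) μ :=
    fun i j => (hf i).integrable_mul (hf j).star
  have hk1 : ∀ i, Φ.koopman 1 (obsMean P F i) =ᵐ[μ] fun x => ∑ j, K i j * obsMean P F j x := by
    intro i
    have h1 := Φ.koopmanL2_coeFn hμ (b i)
    have h2 := Φ.koopman_congr hμ (hf i).coeFn_toLp
    have h3 : ⇑(∑ j, K i j • b j) =ᵐ[μ] fun x => ∑ j, K i j * obsMean P F j x := by
      have h4 : ∀ᵐ x ∂μ, ∀ j, (K i j • b j : Lp ℂ 2 μ) x = K i j * obsMean P F j x := by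
        rw [ae_all_iff]
        intro j
        filter_upwards [Lp.coeFn_smul (K i j) (b j), (hf j).coeFn_toLp] with x hx1 hx2
        rw [hx1, Pi.smul_apply, hx2, smul_eq_mul]
      filter_upwards [Lp.coeFn_fun_finsetSum Finset.univ fun j => K i j • b j, h4] with x hx1 hx2
      rw [hx1]
      exact Finset.sum_congr rfl fun j _ => hx2 j
    rw [← hK i] at h1
    exact (h2.symm.trans h1.symm).trans h3
  -- The two-step operator is the square of the one-step operator by the Markov property, so it acts
  -- on the means through `K²`.
  have hk2 : ∀ i, Φ.koopman ((2 : ℕ) : 𝕋) (obsMean P F i) =ᵐ[μ]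
      fun x => ∑ j, K i j * ∑ l, K j l * obsMean P F l x := by
    intro i
    refine (RandomDynSys.koopman_two hMarkov hμ (hF.measurable_obsMean i)
      ((hf i).integrable one_le_two)).trans ?_
    refine (Φ.koopman_congr hμ (hk1 i)).trans ?_
    have h1 : ∀ᵐ x ∂μ, ∀ j, Integrable (fun ω => obsMean P F j (Φ.T 1 ω x)) P := by
      rw [ae_all_iff]
      intro j
      exact (((hf j).comp_measurePreserving (Φ.measurePreserving_T hμ)).integrable
        one_le_two).prod_right_ae
    filter_upwards [h1, ae_all_iff.2 hk1] with x hx hx1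
    have h2 : ∀ j, ∫ ω, K i j * obsMean P F j (Φ.T 1 ω x) ∂P =
        K i j * ∑ l, K j l * obsMean P F l x := fun j => by
      rw [integral_const_mul, ← hx1 j]; rfl
    simp only [RandomDynSys.koopman, ← h2]
    exact integral_finsetSum _ fun j _ => (hx j).const_mul _
  have hL1 : ∀ i j, ∫ x, Φ.koopman ((1 : ℕ) : 𝕋) (obsMean P F i) x * star (obsMean P F j x) ∂μ =
      (Matrix.of K * G) i j := by
    intro i j
    rw [Nat.cast_one, Matrix.mul_apply]
    simp only [hG, Matrix.of_apply, ← integral_const_mul]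
    rw [← integral_finsetSum _ fun l _ => (hprod l j).const_mul _]
    refine integral_congr_ae ?_
    filter_upwards [hk1 i] with x hx
    rw [hx, Finset.sum_mul]
    exact Finset.sum_congr rfl fun l _ => mul_assoc _ _ _
  have hL2 : ∀ i j, ∫ x, Φ.koopman ((2 : ℕ) : 𝕋) (obsMean P F i) x * star (obsMean P F j x) ∂μ =
      (Matrix.of K * (Matrix.of K * G)) i j := by
    intro i j
    rw [Matrix.mul_apply]
    simp only [← hL1, Matrix.of_apply, ← integral_const_mul]
    rw [← integral_finsetSum _ fun l _ => ?_]
    · refine integral_congr_ae ?_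
      filter_upwards [hk2 i, ae_all_iff.2 hk1] with x hx hx1
      rw [hx, Finset.sum_mul]
      refine Finset.sum_congr rfl fun l _ => ?_
      rw [Nat.cast_one, hx1 l, mul_assoc]
    · rw [Nat.cast_one]
      exact ((Φ.memLp_koopman hμ (hf l)).integrable_mul (hf j).star).const_mul _
  -- The snapshots start at time `1` and the dual ones at time `0`: `G₀` sees lag `1` and `G₁` lag
  -- `2`.
  have h1 : ∀ᵐ p ∂(μ.prod P), ∀ i j, _ := ae_all_iff.2 fun i => ae_all_iff.2 fun j =>
    hF.ae_tendsto_correlation hMarkov hμ herg habs i j one_ne_zero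
  have h2 : ∀ᵐ p ∂(μ.prod P), ∀ i j, _ := ae_all_iff.2 fun i => ae_all_iff.2 fun j =>
    hF.ae_tendsto_correlation hMarkov hμ herg habs i j two_ne_zero
  filter_upwards [h1, h2] with p hp1 hp2
  simp only [hL1] at hp1
  simp only [hL2] at hp2
  exact tendsto_noiseResistantDMD hKdet hGdet hp1 hp2
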